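/- Let $\mathbb K=\mathbb R$ or $\mathbb C$, let $M$ be a (not necessarily connected) time-oriented Lorentzian manifold, let $S\to M$ be a smooth $\mathbb K$-vector bundle of finite rank, and let $P:C^\infty(M,S)\to C^\infty(M,S)$ be a linear differential operator which is Green-hyperbolic, i.e. the restriction of $P$ to every globally hyperbolic open subset of $M$ has advanced and retarded Green's operators. Here a spacetime is globally hyperbolic if it contains a Cauchy hypersurface, that is, a subset which is met exactly once by every inextensible timelike curve, and an advanced (resp. retarded) Green's operator for $P$ on $M$ is a linear map $G_\pm:C^\infty_c(M,S)\to C^\infty(M,S)$ with $P G_\pm\varphi=\varphi$, $G_\pm P\varphi=\varphi$ and $\operatorname{supp}(G_\pm\varphi)\subset J_\pm(\operatorname{supp}\varphi)$ for all $\varphi\in C^\infty_c(M,S)$, with the sign $+$ for advanced and $-$ for retarded, where $J_+(A)$ and $J_-(A)$ are the causal future and past of $A$. Let $G_+$ and $G_-$ be advanced and retarded Green's operators for $P$ on $M$. Let $C^\infty_{sc}(M,S)$ be the space of smooth sections whose support is contained in $J_+(K)\cup J_-(K)$ for some compact $K\subset M$, and put $G:=G_+-G_-:C^\infty_c(M,S)\to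 C^\infty_{sc}(M,S)$. Then the sequence of linear maps $$\{0\}\to C^\infty_c(M,S)\xrightarrow{\ P\ }C^\infty_c(M,S)\xrightarrow{\ G\ }C^\infty_{sc}(M,S)\xrightarrow{\ P\ }C^\infty_{sc}(M,S)$$ is a complex, and it is exact at the first $C^\infty_c(M,S)$. If $M$ is globally hyperbolic, then the complex is exact everywhere, i.e. at both copies of $C^\infty_c(M,S)$ and at the first $C^\infty_{sc}(M,S)$; in particular $G$ then induces a linear isomorphism from $C^\infty_c(M,S)/\ker G$ onto $\{\varphi\in C^\infty_{sc}(M,S): P\varphi=0\}$. -/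

import Mathlib

set_option maxSynthPendingDepth 6

open Set Filter Topology Bundle
open scoped Manifold ContDiff

noncomputable section

set_option linter.unusedSectionVars false

namespace GreenHyp

/-- The model space of an `m`-dimensional manifold. -/
abbrev E (m : ℕ) : Type := EuclideanSpace ℝ (Fin m)

section Geometry

variable {m : ℕ} {M : Type*} [TopologicalSpace M] [ChartedSpace (E m) M]
  [IsManifold (𝓡 m) ∞ M]

/-- A time-oriented Lorentzian metric of signature `(-,+,…,+)` on the manifold `M`:
a smooth symmetric bilinear form on the tangent spaces, each of which contains a negative vector
whose orthogonal complement is positive definite, together with a smooth timelike vector field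
that gives the time orientation. -/
structure SpacetimeStructure (m : ℕ) (M : Type*) [TopologicalSpace M] [ChartedSpace (E m) M]
    [IsManifold (𝓡 m) ∞ M] where
  /-- the metric -/
  metric (x : M) : TangentSpace (𝓡 m) x →L[ℝ] TangentSpace (𝓡 m) x →L[ℝ] ℝ
  metric_symm (x : M) (v w : TangentSpace (𝓡 m) x) : metric x v w = metric x w v
  metric_lorentz (x : M) : ∃ v : TangentSpace (𝓡 m) x, metric x v v < 0 ∧
    ∀ w : TangentSpace (𝓡 m) x, w ≠ 0 → metric x v w = 0 → 0 < metric x w w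
  metric_smooth : ContMDiff (𝓡 m) ((𝓡 m).prod 𝓘(ℝ, E m →L[ℝ] E m →L[ℝ] ℝ)) ∞
    (fun x : M => TotalSpace.mk' (E m →L[ℝ] E m →L[ℝ] ℝ)
      (E := fun x : M => TangentSpace (𝓡 m) x →L[ℝ] TangentSpace (𝓡 m) x →L[ℝ] ℝ) x (metric x))
  /-- the time orientation -/
  timeField (x : M) : TangentSpace (𝓡 m) x
  timeField_timelike (x : M) : metric x (timeField x) (timeField x) < 0
  timeField_smooth : ContMDiff (𝓡 m) ((𝓡 m).prod 𝓘(ℝ, E m)) ∞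
    (fun x : M => TotalSpace.mk' (E m) (E := fun x : M => TangentSpace (𝓡 m) x) x (timeField x))

namespace SpacetimeStructure

variable (g : SpacetimeStructure m M)

/-- Future-directed causal tangent vectors (these are nonzero). -/
def FutureCausal {x : M} (v : TangentSpace (𝓡 m) x) : Prop :=
  g.metric x v v ≤ 0 ∧ g.metric x (g.timeField x) v < 0

/-- Future-directed timelike tangent vectors. -/
def FutureTimelike {x : M} (v : TangentSpace (𝓡 m) x) : Prop :=
  g.metric x v v < 0 ∧ g.metric x (g.timeField x) v < 0

/-- The velocity of `γ` at `t`, as a curve on `[a, b]` (one-sided at the end points). -/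
def velocity (γ : ℝ → M) (a b t : ℝ) : TangentSpace (𝓡 m) (γ t) :=
  mfderivWithin 𝓘(ℝ, ℝ) (𝓡 m) γ (Icc a b) t (1 : ℝ)

/-- `γ` restricted to `[a, b]` is a future-directed causal `C¹` curve. -/
def IsCausalArc (γ : ℝ → M) (a b : ℝ) : Prop :=
  a < b ∧ ContMDiffOn 𝓘(ℝ, ℝ) (𝓡 m) 1 γ (Icc a b) ∧
    ∀ t ∈ Icc a b, g.FutureCausal (velocity γ a b t)

/-- `γ` restricted to `[a, b]` is a future-directed timelike `C¹` curve. -/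
def IsTimelikeArc (γ : ℝ → M) (a b : ℝ) : Prop :=
  a < b ∧ ContMDiffOn 𝓘(ℝ, ℝ) (𝓡 m) 1 γ (Icc a b) ∧
    ∀ t ∈ Icc a b, g.FutureTimelike (velocity γ a b t)

/-- `q` is the end point of a future-directed causal `C¹` curve in `Ω` that starts at `p`. -/
def CausalStep (Ω : Set M) (p q : M) : Prop :=
  ∃ (γ : ℝ → M) (a b : ℝ), g.IsCausalArc γ a b ∧ (∀ t ∈ Icc a b, γ t ∈ Ω) ∧ γ a = p ∧ γ b = q

/-- `q = p`, or `q` is the end point of a future-directed causal piecewise `C¹` curve in `Ω` that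
starts at `p`. -/
def CausalLE (Ω : Set M) (p q : M) : Prop := Relation.ReflTransGen (g.CausalStep Ω) p q

/-- The causal future `J₊^Ω(A)`. -/
def causalFuture (Ω A : Set M) : Set M := {q | ∃ p ∈ A ∩ Ω, g.CausalLE Ω p q}

/-- The causal past `J₋^Ω(A)`. -/
def causalPast (Ω A : Set M) : Set M := {q | ∃ p ∈ A ∩ Ω, g.CausalLE Ω q p}

/-- A future-directed timelike piecewise `C¹` curve in `Ω` without a limit in `Ω` at either end.
An inextensible curve is defined on an open interval, which may be taken to be the real line.
Being piecewise `C¹` means that, around each parameter, the curve is `C¹` up to the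
parameter from the left and from the right. -/
def IsInextensibleTimelike (Ω : Set M) (γ : ℝ → M) : Prop :=
  (∀ t, γ t ∈ Ω) ∧
  (∀ t, ∃ ε > 0, g.IsTimelikeArc γ (t - ε) t ∧ g.IsTimelikeArc γ t (t + ε)) ∧
  (¬ ∃ p ∈ Ω, Tendsto γ atTop (𝓝 p)) ∧ (¬ ∃ p ∈ Ω, Tendsto γ atBot (𝓝 p))

/-- A Cauchy hypersurface of the open subset `Ω`: a subset that every inextensible
timelike curve of `Ω` meets exactly once. -/
def IsCauchyHypersurface (Ω S : Set M) : Prop :=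
  S ⊆ Ω ∧ ∀ γ : ℝ → M, g.IsInextensibleTimelike Ω γ → ∃! t, γ t ∈ S

/-- The open subset `Ω`, as a spacetime of its own, is globally hyperbolic. -/
def GloballyHyperbolic (Ω : Set M) : Prop := ∃ S : Set M, g.IsCauchyHypersurface Ω S

end SpacetimeStructure

end Geometry

section Sections

variable (m : ℕ) {M : Type*} [TopologicalSpace M] [ChartedSpace (E m) M]
  [IsManifold (𝓡 m) ∞ M]
  (𝕜 : Type*) [RCLike 𝕜]
  (F : Type*) [NormedAddCommGroup F] [NormedSpace ℝ F] [NormedSpace 𝕜 F] [IsScalarTower ℝ 𝕜 F]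
  (V : M → Type*) [TopologicalSpace (TotalSpace F V)] [∀ x, TopologicalSpace (V x)]
  [∀ x, AddCommGroup (V x)] [∀ x, Module ℝ (V x)] [∀ x, Module 𝕜 (V x)]
  [FiberBundle F V] [VectorBundle ℝ F V] [VectorBundle 𝕜 F V]

/-- `C^∞(Ω, V)`, the smooth sections over the open subset `Ω`. A section over `Ω` is represented
by the family on `M` which agrees with it on `Ω` and is `0` off `Ω`. -/
def smoothSections (Ω : Set M) : Submodule 𝕜 (∀ x : M, V x) where
  carrier := {s | ContMDiffOn (𝓡 m) ((𝓡 m).prod 𝓘(ℝ, F)) ∞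
      (fun x : M => TotalSpace.mk' F x (s x)) Ω ∧ ∀ x ∉ Ω, s x = 0}
  add_mem' := by
    rintro s t ⟨hs, hs'⟩ ⟨ht, ht'⟩
    exact ⟨hs.add_section ht, fun x hx => by simp [hs' x hx, ht' x hx]⟩
  zero_mem' := ⟨contMDiffOn_zeroSection ℝ V, fun _ _ => rfl⟩
  smul_mem' := by
    rintro c s ⟨hs, hs'⟩
    refine ⟨fun x₀ hx₀ => ?_, fun x hx => by simp [hs' x hx]⟩
    have h := hs x₀ hx₀
    rw [contMDiffWithinAt_section] at h ⊢
    set e := trivializationAt F V x₀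
    let L : F →L[ℝ] F := c • ContinuousLinearMap.id ℝ F
    refine (L.contMDiff.contMDiffAt.comp_contMDiffWithinAt x₀ h).congr_of_eventuallyEq ?_ ?_
    · refine eventually_of_mem (U := e.baseSet) ?_ ?_
      · exact mem_nhdsWithin_of_mem_nhds
          (e.open_baseSet.mem_nhds (FiberBundle.mem_baseSet_trivializationAt F V x₀))
      · intro x hx
        exact (e.linear 𝕜 hx).2 c (s x)
    · exact (e.linear 𝕜 (FiberBundle.mem_baseSet_trivializationAt F V x₀)).2 c (s x₀)

variable {m 𝕜 F V}

/-- The support, relative to `Ω`, of a section over `Ω`. -/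
def secSupp {Ω : Set M} (s : smoothSections m 𝕜 F V Ω) : Set M :=
  closure {x | (s : ∀ x, V x) x ≠ 0} ∩ Ω


lemma secSupp_zero {Ω : Set M} : secSupp (0 : smoothSections m 𝕜 F V Ω) = ∅ := by
  simp [secSupp]

lemma secSupp_add {Ω : Set M} (s t : smoothSections m 𝕜 F V Ω) :
    secSupp (s + t) ⊆ secSupp s ∪ secSupp t := by
  rw [secSupp, secSupp, secSupp, ← union_inter_distrib_right, ← closure_union]
  refine inter_subset_inter_left _ (closure_mono fun x hx => ?_)
  by_contra h
  simp only [mem_union, mem_ofPred_eq, not_or, not_not] at h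
  exact hx (by simp [h.1, h.2])

lemma secSupp_smul {Ω : Set M} (c : 𝕜) (s : smoothSections m 𝕜 F V Ω) :
    secSupp (c • s) ⊆ secSupp s := by
  refine inter_subset_inter_left _ (closure_mono fun x hx h => hx ?_)
  simp [h]

lemma isCompact_secSupp_of_subset {Ω : Set M} (s : smoothSections m 𝕜 F V Ω) {K : Set M}
    (hK : IsCompact K) (h : secSupp s ⊆ K) (hKΩ : K ⊆ Ω) : IsCompact (secSupp s) := by
  have : secSupp s = K ∩ closure {x | (s : ∀ x, V x) x ≠ 0} := by
    ext x
    exact ⟨fun hx => ⟨h hx, hx.1⟩, fun hx => ⟨hx.2, hKΩ hx.1⟩⟩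
  rw [this]
  exact hK.inter_right isClosed_closure

variable (m 𝕜 F V) in
/-- `C_c^∞(Ω, V)`, the smooth sections over `Ω` with compact support in `Ω`. -/
def compactSections (Ω : Set M) : Submodule 𝕜 (smoothSections m 𝕜 F V Ω) where
  carrier := {s | IsCompact (secSupp s)}
  add_mem' {s t} hs ht := isCompact_secSupp_of_subset _ (hs.union ht) (secSupp_add s t)
    (union_subset inter_subset_right inter_subset_right)
  zero_mem' := by simp [secSupp_zero]
  smul_mem' c s hs := isCompact_secSupp_of_subset _ hs (secSupp_smul c s) inter_subset_right

variable (𝕜 F V) in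
/-- `C_sc^∞(Ω, V)`, the smooth sections over `Ω` with spacelike compact support: the support
(which is closed in `Ω`) lies in `J₋^Ω(K) ∪ J₊^Ω(K)` for a compact subset `K` of `Ω`. -/
def spacelikeCompactSections (g : SpacetimeStructure m M) (Ω : Set M) :
    Submodule 𝕜 (smoothSections m 𝕜 F V Ω) where
  carrier := {s | ∃ K ⊆ Ω, IsCompact K ∧ secSupp s ⊆ g.causalPast Ω K ∪ g.causalFuture Ω K}
  add_mem' := by
    rintro s t ⟨K, hKΩ, hK, hs⟩ ⟨L, hLΩ, hL, ht⟩
    refine ⟨K ∪ L, union_subset hKΩ hLΩ, hK.union hL, (secSupp_add s t).trans ?_⟩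
    rintro x (hx | hx)
    · rcases hs hx with ⟨p, hp, h⟩ | ⟨p, hp, h⟩
      · exact Or.inl ⟨p, ⟨Or.inl hp.1, hp.2⟩, h⟩
      · exact Or.inr ⟨p, ⟨Or.inl hp.1, hp.2⟩, h⟩
    · rcases ht hx with ⟨p, hp, h⟩ | ⟨p, hp, h⟩
      · exact Or.inl ⟨p, ⟨Or.inr hp.1, hp.2⟩, h⟩
      · exact Or.inr ⟨p, ⟨Or.inr hp.1, hp.2⟩, h⟩
  zero_mem' := ⟨∅, empty_subset _, isCompact_empty, by simp [secSupp_zero]⟩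
  smul_mem' := by
    rintro c s ⟨K, hKΩ, hK, hs⟩
    exact ⟨K, hKΩ, hK, (secSupp_smul c s).trans hs⟩

/-- The partial derivative `∂f/∂xⁱ` of a function on the model space. -/
def partialDeriv (i : Fin m) (f : E m → F) : E m → F :=
  fun y => fderiv ℝ f y (EuclideanSpace.single i 1)

/-- The iterated partial derivative `∂^α f / ∂x^α` for a multi-index `α`. -/
def multiDeriv (α : Fin m → ℕ) (f : E m → F) : E m → F :=
  (List.finRange m).foldr (fun i h => (partialDeriv i)^[α i] h) f

variable (m F) in
/-- The section `s` in the local coordinates and the local trivialization around `x₀`. -/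
def localRep (x₀ : M) (s : ∀ x, V x) : E m → F :=
  fun y => (trivializationAt F V x₀
    ⟨(chartAt (E m) x₀).symm y, s ((chartAt (E m) x₀).symm y)⟩).2

variable (m F V) in
/-- The part of `Ω` on which the local coordinates and the local trivialization around `x₀`
are both defined, in coordinates. -/
def localDomain (Ω : Set M) (x₀ : M) : Set (E m) :=
  {y ∈ (chartAt (E m) x₀).target |
    (chartAt (E m) x₀).symm y ∈ (trivializationAt F V x₀).baseSet ∩ Ω}

/-- A linear map `P : C^∞(Ω, V) → C^∞(Ω, V)` is a differential operator of order at most `k` if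
in local coordinates and local trivializations around every point it has the form
`∑_{|α| ≤ k} A_α(x) ∂^α/∂x^α` with smooth matrix-valued coefficients `A_α`. -/
def IsDiffOp {Ω : Set M} (k : ℕ) (P : smoothSections m 𝕜 F V Ω →ₗ[𝕜] smoothSections m 𝕜 F V Ω) :
    Prop :=
  ∀ x₀ ∈ Ω, ∃ A : (Fin m → ℕ) → E m → (F →L[𝕜] F),
    (∀ α, ContDiffOn ℝ ∞ (A α) (localDomain m F V Ω x₀)) ∧
    ∀ (s : smoothSections m 𝕜 F V Ω), ∀ y ∈ localDomain m F V Ω x₀,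
      localRep m F x₀ (P s : ∀ x, V x) y =
        ∑ j ∈ Finset.range (k + 1), ∑ α ∈ Finset.piAntidiag Finset.univ j,
          A α y (multiDeriv α (localRep m F x₀ (s : ∀ x, V x)) y)

variable (m 𝕜 F V) in
/-- Linear differential operators (of some order) acting on the sections of `V` over `Ω`. -/
structure DiffOp (Ω : Set M) where
  /-- the linear map -/
  toLin : smoothSections m 𝕜 F V Ω →ₗ[𝕜] smoothSections m 𝕜 F V Ω
  isDiffOp : ∃ k, IsDiffOp k toLin

lemma partialDeriv_eventually_zero {i : Fin m} {f : E m → F} {y : E m} (h : f =ᶠ[𝓝 y] 0) :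
    partialDeriv i f =ᶠ[𝓝 y] 0 := by
  filter_upwards [h.eventuallyEq_nhds] with z hz
  simp [partialDeriv, hz.fderiv_eq]

lemma multiDeriv_eventually_zero (α : Fin m → ℕ) {f : E m → F} {y : E m} (h : f =ᶠ[𝓝 y] 0) :
    multiDeriv α f =ᶠ[𝓝 y] 0 := by
  unfold multiDeriv
  induction List.finRange m with
  | nil => exact h
  | cons i l ih =>
    simp only [List.foldr_cons]
    induction α i with
    | zero => exact ih
    | succ n ihn =>
      rw [Function.iterate_succ_apply']
      exact partialDeriv_eventually_zero ihn

namespace DiffOp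

variable {Ω : Set M} (P : DiffOp m 𝕜 F V Ω)

/-- Differential operators do not enlarge supports. -/
lemma secSupp_toLin (s : smoothSections m 𝕜 F V Ω) : secSupp (P.toLin s) ⊆ secSupp s := by
  suffices h : {x | (P.toLin s : ∀ x, V x) x ≠ 0} ⊆ closure {x | (s : ∀ x, V x) x ≠ 0} by
    exact inter_subset_inter_left _ (closure_minimal h isClosed_closure)
  intro x hx
  by_contra hxs
  apply hx
  by_cases hxΩ : x ∈ Ω
  swap
  · exact (P.toLin s).2.2 x hxΩ
  obtain ⟨k, hk⟩ := P.isDiffOp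
  obtain ⟨A, -, hA⟩ := hk x hxΩ
  set c := chartAt (E m) x with hc
  set e := trivializationAt F V x with he
  have hxc : x ∈ c.source := mem_chart_source (E m) x
  have hxe : x ∈ e.baseSet := FiberBundle.mem_baseSet_trivializationAt F V x
  have hsymm : c.symm (c x) = x := c.left_inv hxc
  have hdom : c x ∈ localDomain m F V Ω x := by
    refine ⟨c.map_source hxc, ?_⟩
    rw [hsymm]
    exact ⟨hxe, hxΩ⟩
  have hrep : localRep m F x (s : ∀ x, V x) =ᶠ[𝓝 (c x)] 0 := by
    have hcont : Tendsto c.symm (𝓝 (c x)) (𝓝 x) := by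
      have := c.continuousAt_symm (c.map_source hxc)
      rwa [ContinuousAt, hsymm] at this
    have h1 : ∀ᶠ z in 𝓝 x, z ∈ e.baseSet ∧ (s : ∀ x, V x) z = 0 := by
      filter_upwards [e.open_baseSet.mem_nhds hxe,
        isClosed_closure.isOpen_compl.mem_nhds hxs] with z hz hz'
      refine ⟨hz, ?_⟩
      by_contra h
      exact hz' (subset_closure h)
    filter_upwards [hcont.eventually h1] with y hy
    show (e ⟨c.symm y, (s : ∀ x, V x) (c.symm y)⟩).2 = 0
    rw [hy.2]
    exact (e.linear ℝ hy.1).map_zero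
  have hval := hA s (c x) hdom
  have hz : localRep m F x (P.toLin s : ∀ x, V x) (c x) = 0 := by
    rw [hval]
    refine Finset.sum_eq_zero fun j _ => Finset.sum_eq_zero fun α _ => ?_
    rw [(multiDeriv_eventually_zero α hrep).eq_of_nhds]
    simp
  have key : ∀ z, z = x → (e ⟨z, (P.toLin s : ∀ x, V x) z⟩).2 = 0 →
      (P.toLin s : ∀ x, V x) z = 0 := by
    rintro z rfl h0
    refine (e.linearEquivAt ℝ z hxe).injective ?_
    rw [map_zero]
    exact h0
  exact key x rfl (by
    have := hz
    simp only [localRep] at this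
    rw [← hc, ← he, hsymm] at this
    exact this)

/-- `P : C_c^∞ → C_c^∞`. -/
def onCompact : compactSections m 𝕜 F V Ω →ₗ[𝕜] compactSections m 𝕜 F V Ω :=
  P.toLin.restrict fun s hs => isCompact_secSupp_of_subset _ hs (P.secSupp_toLin s) inter_subset_right

/-- `P : C_sc^∞ → C_sc^∞`. -/
def onSpacelikeCompact (g : SpacetimeStructure m M) :
    spacelikeCompactSections 𝕜 F V g Ω →ₗ[𝕜] spacelikeCompactSections 𝕜 F V g Ω :=
  P.toLin.restrict fun s hs => by
    obtain ⟨K, hKΩ, hK, h⟩ := hs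
    exact ⟨K, hKΩ, hK, (P.secSupp_toLin s).trans h⟩

/-- `G` is an advanced Green's operator for `P` on `Ω`. -/
structure IsAdvancedGreen (g : SpacetimeStructure m M)
    (G : compactSections m 𝕜 F V Ω →ₗ[𝕜] smoothSections m 𝕜 F V Ω) : Prop where
  right_inv (φ : compactSections m 𝕜 F V Ω) : P.toLin (G φ) = φ
  left_inv (φ : compactSections m 𝕜 F V Ω) : G (P.onCompact φ) = φ
  supp (φ : compactSections m 𝕜 F V Ω) :
    secSupp (G φ) ⊆ g.causalFuture Ω (secSupp (φ : smoothSections m 𝕜 F V Ω))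

/-- `G` is a retarded Green's operator for `P` on `Ω`. -/
structure IsRetardedGreen (g : SpacetimeStructure m M)
    (G : compactSections m 𝕜 F V Ω →ₗ[𝕜] smoothSections m 𝕜 F V Ω) : Prop where
  right_inv (φ : compactSections m 𝕜 F V Ω) : P.toLin (G φ) = φ
  left_inv (φ : compactSections m 𝕜 F V Ω) : G (P.onCompact φ) = φ
  supp (φ : compactSections m 𝕜 F V Ω) :
    secSupp (G φ) ⊆ g.causalPast Ω (secSupp (φ : smoothSections m 𝕜 F V Ω))

/-- `Q` is the restriction to `Ω` of the differential operator `P` on `M`. -/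
def IsRestriction (P : DiffOp m 𝕜 F V (univ : Set M)) (Q : DiffOp m 𝕜 F V Ω) : Prop :=
  ∀ (s : smoothSections m 𝕜 F V (univ : Set M)) (t : smoothSections m 𝕜 F V Ω),
    (∀ x ∈ Ω, (s : ∀ x, V x) x = (t : ∀ x, V x) x) →
    ∀ x ∈ Ω, (P.toLin s : ∀ x, V x) x = (Q.toLin t : ∀ x, V x) x

/-- `P` is Green-hyperbolic: its restriction to any globally hyperbolic open subset of `M` has
advanced and retarded Green's operators. -/
def GreenHyperbolic (g : SpacetimeStructure m M) (P : DiffOp m 𝕜 F V (univ : Set M)) : Prop :=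
  ∀ Ω : Set M, IsOpen Ω → g.GloballyHyperbolic Ω →
    ∃ Q : DiffOp m 𝕜 F V Ω, P.IsRestriction Q ∧
      (∃ Gp, Q.IsAdvancedGreen g Gp) ∧ (∃ Gm, Q.IsRetardedGreen g Gm)

variable {P} {g : SpacetimeStructure m M}
  {Gp Gm : compactSections m 𝕜 F V Ω →ₗ[𝕜] smoothSections m 𝕜 F V Ω}

/-- The map `G = G₊ - G₋ : C_c^∞ → C_sc^∞`. -/
def causalPropagator (hGp : P.IsAdvancedGreen g Gp) (hGm : P.IsRetardedGreen g Gm) :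
    compactSections m 𝕜 F V Ω →ₗ[𝕜] spacelikeCompactSections 𝕜 F V g Ω :=
  (Gp - Gm).codRestrict _ fun φ => by
    have hp : Gp φ ∈ spacelikeCompactSections 𝕜 F V g Ω :=
      ⟨secSupp φ.1, inter_subset_right, φ.2, (hGp.supp φ).trans subset_union_right⟩
    have hm : Gm φ ∈ spacelikeCompactSections 𝕜 F V g Ω :=
      ⟨secSupp φ.1, inter_subset_right, φ.2, (hGm.supp φ).trans subset_union_left⟩
    exact Submodule.sub_mem _ hp hm

end DiffOp

end Sections
end GreenHyp

end

/-!
The sequence is a complex, and `P` is injective on sections of compact support, because `G₊` and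
`G₋` are two-sided inverses of `P` there. Everything else rests on one geometric fact about globally
hyperbolic spacetimes (`GloballyHyperbolic.exists_compact_diamond`): `J₊(K) ∩ J₋(K')` is relatively
compact for compact `K` and `K'`.

*From the geometry to exactness.* If `G φ = 0`, then `G₊ φ = G₋ φ` has support in
`J₊(supp φ) ∩ J₋(supp φ)`, so it has compact support, and `P` maps it to `φ`. If `P s = 0` with `s`
of spacelike compact support, a cutoff function gives `s = s₁ + s₂` with `s₁` supported in some
`J₊(K₁)` and `s₂` in some `J₋(K₂)`, both compact sets being slight enlargements of the given one
(`exists_future_past_decomposition`). Then `ψ = P s₁ = -P s₂` has compact support, and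
`G₊ ψ = s₁`, `G₋ ψ = -s₂`, so that `G ψ = s`. The last two equations are uniqueness statements
(`IsAdvancedGreen.eq_zero_of_secSupp_subset`): a solution `u` of `P u = 0` with support in `J₊(K)`
vanishes at each `x`, because for a cutoff function `χ` that is `1` near the relatively compact set
`J₋(x) ∩ J₊(K)` one has `χ u = G₊ P (χ u)`, where `P (χ u)` vanishes on `J₋(x)`. No formally dual
operator is needed. The statements about the past follow from those about the future by reversing
the time orientation.

*The geometry.* Only a Cauchy hypersurface `S` is given, so that the compactness has to come from
the existence of inextensible timelike curves. Each of them meets `S`, hence each point is on `S`,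
before `S` or after `S`, and no timelike curve leads from `S` to `S`. By time reversal it is enough
to bound the part of `J₊(K)` that is on or before `S`
(`IsCauchyHypersurface.exists_compact_causalFuture`). If it is not relatively compact, an ultrafilter
on it leaves every compact set. The limits, along the ultrafilter, of points on causal curves that
lead to the points `q` of the ultrafilter form a set `A` which contains a point of `K`, and which can
be left through the boundary of any small open set. Moving from boundary to boundary, always
slightly before the points of `A`, one obtains a timelike curve without a future limit
(`Escapes.exists_seq`). All its points are before some `q`, thus before `S`, although the curve,
extended to the past, meets `S`.

*The local step.* Passing from limits of causal curves to timelike curves uses, in coordinates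
around a point, the affine maps `y ↦ y - δ (1 - C τ(y)) e` with a timelike vector `e` and a linear
time function `τ` (`exists_pastPush`). They turn causal curves into timelike ones: the metric
changes by `O(δ)`, which is outweighed by the term `δ C τ(v) e` in the differential. This replaces
geodesics, normal neighbourhoods and limit curves, and it also gives the push-up property of the
chronological relation (`StablyBefore.of_causalLE`).
-/

noncomputable section

set_option linter.unusedSectionVars false

/-! ### Arcs and the reversal of time -/

namespace GreenHyp

section Arcs

variable {m : ℕ} {M : Type*} [TopologicalSpace M] [ChartedSpace (E m) M]
  [IsManifold (𝓡 m) ∞ M]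

namespace SpacetimeStructure

/-- A `C¹` arc on `[a, b]` whose velocity satisfies `C`; the causal and the timelike arcs are the
two instances of interest. -/
def IsArc (C : ∀ x : M, TangentSpace (𝓡 m) x → Prop) (γ : ℝ → M) (a b : ℝ) : Prop :=
  a < b ∧ ContMDiffOn 𝓘(ℝ, ℝ) (𝓡 m) 1 γ (Icc a b) ∧
    ∀ t ∈ Icc a b, C (γ t) (velocity γ a b t)

lemma IsArc.congr {C : ∀ x : M, TangentSpace (𝓡 m) x → Prop} {γ γ' : ℝ → M} {a b : ℝ}
    (h : IsArc C γ a b) (hγ : ∀ t ∈ Icc a b, γ' t = γ t) : IsArc C γ' a b := by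
  refine ⟨h.1, h.2.1.congr hγ, fun t ht => ?_⟩
  have h1 := h.2.2 t ht
  have h2 : (mfderivWithin 𝓘(ℝ, ℝ) (𝓡 m) γ' (Icc a b) t : ℝ →L[ℝ] E m) =
      mfderivWithin 𝓘(ℝ, ℝ) (𝓡 m) γ (Icc a b) t := mfderivWithin_congr_of_mem hγ ht
  have key : ∀ (y : M) (v : E m), y = γ t →
      v = (mfderivWithin 𝓘(ℝ, ℝ) (𝓡 m) γ (Icc a b) t : ℝ →L[ℝ] E m) 1 → C y v := by
    rintro y v rfl rfl
    exact h1
  exact key _ _ (hγ t ht) (by rw [← h2]; rfl)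

/-- Affine reparametrization of arcs. It covers the restriction to a subinterval (`α = 1`,
`β = 0`), translations, rescalings, and the reversal of arcs (`α = -1`). -/
lemma IsArc.comp_affine {C C' : ∀ x : M, TangentSpace (𝓡 m) x → Prop} {γ : ℝ → M} {a b a' b' : ℝ}
    (h : IsArc C γ a b) (α β : ℝ) (hC : ∀ x v, C x v → C' x (α • v)) (hab : a' < b')
    (hm : ∀ s ∈ Icc a' b', α * s + β ∈ Icc a b) :
    IsArc C' (fun s => γ (α * s + β)) a' b' := by
  have haff : ContMDiff 𝓘(ℝ, ℝ) 𝓘(ℝ, ℝ) 1 (fun s : ℝ => α * s + β) := by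
    rw [contMDiff_iff_contDiff]; fun_prop
  refine ⟨hab, h.2.1.comp haff.contMDiffOn hm, fun s hs => ?_⟩
  have hu : UniqueMDiffWithinAt 𝓘(ℝ, ℝ) (Icc a' b') s :=
    (uniqueDiffOn_Icc hab s hs).uniqueMDiffWithinAt
  have hd : MDifferentiableWithinAt 𝓘(ℝ, ℝ) (𝓡 m) γ (Icc a b) (α * s + β) :=
    (h.2.1 _ (hm s hs)).mdifferentiableWithinAt one_ne_zero
  have hd' : MDifferentiableWithinAt 𝓘(ℝ, ℝ) 𝓘(ℝ, ℝ) (fun s : ℝ => α * s + β) (Icc a' b') s :=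
    (haff.contMDiffAt.mdifferentiableAt one_ne_zero).mdifferentiableWithinAt
  have h1 := mfderivWithin_comp s (g := γ) (f := fun s : ℝ => α * s + β) hd hd' hm hu
  have h2 : mfderivWithin 𝓘(ℝ, ℝ) 𝓘(ℝ, ℝ) (fun s : ℝ => α * s + β) (Icc a' b') s (1 : ℝ) = α := by
    rw [mfderivWithin_eq_fderivWithin]
    have : HasDerivWithinAt (fun s : ℝ => α * s + β) (α * 1) (Icc a' b') s :=
      (((hasDerivAt_id s).const_mul α).add_const β).hasDerivWithinAt
    have h3 := this.derivWithin (uniqueDiffOn_Icc hab s hs)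
    rw [mul_one] at h3
    exact h3
  have h4 : velocity (m := m) (fun s => γ (α * s + β)) a' b' s = α • velocity (m := m) γ a b (α * s + β) := by
    have h5 := congrArg (fun L => L (1 : ℝ)) h1
    have h6 : velocity (m := m) (fun s => γ (α * s + β)) a' b' s =
      (mfderivWithin 𝓘(ℝ, ℝ) (𝓡 m) γ (Icc a b) (α * s + β))
        (mfderivWithin 𝓘(ℝ, ℝ) 𝓘(ℝ, ℝ) (fun s : ℝ => α * s + β) (Icc a' b') s (1 : ℝ)) := h5
    rw [h6, h2]
    have h7 : ∀ L : ℝ →L[ℝ] E m, L α = α • L 1 := fun L => by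
      rw [← L.map_smul, smul_eq_mul, mul_one]
    exact h7 _
  rw [h4]
  exact hC _ _ (h.2.2 _ (hm s hs))

lemma IsArc.mono {C : ∀ x : M, TangentSpace (𝓡 m) x → Prop} {γ : ℝ → M} {a b a' b' : ℝ}
    (h : IsArc C γ a b) (hab : a' < b') (ha : a ≤ a') (hb : b' ≤ b) : IsArc C γ a' b' := by
  have := h.comp_affine (C' := C) 1 0 (fun x v hv => by rwa [one_smul]) hab
    (fun s hs => by simpa using ⟨ha.trans hs.1, hs.2.trans hb⟩)
  simpa using this

variable (g : SpacetimeStructure m M)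

/-- The same metric with the opposite time orientation. -/
def reverse : SpacetimeStructure m M where
  metric := g.metric
  metric_symm := g.metric_symm
  metric_lorentz := g.metric_lorentz
  metric_smooth := g.metric_smooth
  timeField x := -g.timeField x
  timeField_timelike x := by simpa using g.timeField_timelike x
  timeField_smooth := g.timeField_smooth.neg_section

lemma reverse_reverse : g.reverse.reverse = g := by
  cases g
  simp [reverse]

lemma futureTimelike_smul {x : M} {v : TangentSpace (𝓡 m) x} {α : ℝ} (hα : 0 < α)
    (hv : g.FutureTimelike v) : g.FutureTimelike (α • v) := by
  refine ⟨?_, ?_⟩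
  · simp only [map_smul, smul_apply, smul_eq_mul]
    exact mul_neg_of_pos_of_neg hα (mul_neg_of_pos_of_neg hα hv.1)
  · simp only [map_smul, smul_eq_mul]
    exact mul_neg_of_pos_of_neg hα hv.2

lemma futureTimelike_reverse_neg {x : M} {v : TangentSpace (𝓡 m) x}
    (hv : g.FutureTimelike v) : g.reverse.FutureTimelike ((-1 : ℝ) • v) := by
  refine ⟨?_, ?_⟩
  · simpa [reverse] using hv.1
  · simpa [reverse] using hv.2

lemma futureCausal_reverse_neg {x : M} {v : TangentSpace (𝓡 m) x}
    (hv : g.FutureCausal v) : g.reverse.FutureCausal ((-1 : ℝ) • v) := by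
  refine ⟨?_, ?_⟩
  · simpa [reverse] using hv.1
  · simpa [reverse] using hv.2

lemma isCausalArc_iff {γ : ℝ → M} {a b : ℝ} :
    g.IsCausalArc γ a b ↔ IsArc (fun _ v => g.FutureCausal v) γ a b := Iff.rfl

lemma isTimelikeArc_iff {γ : ℝ → M} {a b : ℝ} :
    g.IsTimelikeArc γ a b ↔ IsArc (fun _ v => g.FutureTimelike v) γ a b := Iff.rfl

variable {g}

lemma IsTimelikeArc.reverse {γ : ℝ → M} {a b : ℝ} (h : g.IsTimelikeArc γ a b) :
    g.reverse.IsTimelikeArc (fun t => γ (-t)) (-b) (-a) := by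
  have := IsArc.comp_affine (C' := fun _ v => g.reverse.FutureTimelike v)
    (g.isTimelikeArc_iff.1 h) (-1) 0
    (fun x v hv => g.futureTimelike_reverse_neg hv) (neg_lt_neg h.1)
    (fun s hs => by constructor <;> linarith [hs.1, hs.2])
  simpa [isTimelikeArc_iff] using this

lemma IsCausalArc.reverse {γ : ℝ → M} {a b : ℝ} (h : g.IsCausalArc γ a b) :
    g.reverse.IsCausalArc (fun t => γ (-t)) (-b) (-a) := by
  have := IsArc.comp_affine (C' := fun _ v => g.reverse.FutureCausal v)
    (g.isCausalArc_iff.1 h) (-1) 0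
    (fun x v hv => g.futureCausal_reverse_neg hv) (neg_lt_neg h.1)
    (fun s hs => by constructor <;> linarith [hs.1, hs.2])
  simpa [isCausalArc_iff] using this

lemma IsTimelikeArc.mono {γ : ℝ → M} {a b a' b' : ℝ} (h : g.IsTimelikeArc γ a b)
    (hab : a' < b') (ha : a ≤ a') (hb : b' ≤ b) : g.IsTimelikeArc γ a' b' :=
  IsArc.mono (C := fun _ v => g.FutureTimelike v) h hab ha hb

lemma IsCausalArc.mono {γ : ℝ → M} {a b a' b' : ℝ} (h : g.IsCausalArc γ a b)
    (hab : a' < b') (ha : a ≤ a') (hb : b' ≤ b) : g.IsCausalArc γ a' b' :=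
  IsArc.mono (C := fun _ v => g.FutureCausal v) h hab ha hb

lemma IsTimelikeArc.congr {γ γ' : ℝ → M} {a b : ℝ} (h : g.IsTimelikeArc γ a b)
    (hγ : ∀ t ∈ Icc a b, γ' t = γ t) : g.IsTimelikeArc γ' a b :=
  IsArc.congr (C := fun _ v => g.FutureTimelike v) h hγ

lemma IsTimelikeArc.comp_affine {γ : ℝ → M} {a b a' b' α β : ℝ} (h : g.IsTimelikeArc γ a b)
    (hα : 0 < α) (hab : a' < b') (hm : ∀ s ∈ Icc a' b', α * s + β ∈ Icc a b) :
    g.IsTimelikeArc (fun s => γ (α * s + β)) a' b' :=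
  IsArc.comp_affine (C := fun _ v => g.FutureTimelike v) h α β
    (fun _ _ hv => g.futureTimelike_smul hα hv) hab hm

lemma IsCausalArc.continuousOn {γ : ℝ → M} {a b : ℝ} (h : g.IsCausalArc γ a b) :
    ContinuousOn γ (Icc a b) := h.2.1.continuousOn

lemma IsTimelikeArc.isCausalArc {γ : ℝ → M} {a b : ℝ} (h : g.IsTimelikeArc γ a b) :
    g.IsCausalArc γ a b :=
  ⟨h.1, h.2.1, fun t ht => ⟨(h.2.2 t ht).1.le, (h.2.2 t ht).2⟩⟩

lemma CausalStep.reverse {Ω : Set M} {p q : M} (h : g.CausalStep Ω p q) :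
    g.reverse.CausalStep Ω q p := by
  obtain ⟨γ, a, b, hγ, hΩ, rfl, rfl⟩ := h
  exact ⟨_, _, _, hγ.reverse, fun t ht => hΩ _ ⟨by linarith [ht.2], by linarith [ht.1]⟩,
    by simp, by simp⟩

lemma CausalLE.reverse {Ω : Set M} {p q : M} (h : g.CausalLE Ω p q) :
    g.reverse.CausalLE Ω q p := by
  induction h with
  | refl => exact .refl
  | tail _ h2 ih => exact .head h2.reverse ih

variable (g) in
lemma causalLE_reverse {Ω : Set M} {p q : M} : g.reverse.CausalLE Ω p q ↔ g.CausalLE Ω q p :=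
  ⟨fun h => by simpa [reverse_reverse] using h.reverse, CausalLE.reverse⟩

variable (g) in
lemma causalFuture_reverse (Ω A : Set M) : g.reverse.causalFuture Ω A = g.causalPast Ω A := by
  ext q; simp [causalFuture, causalPast, causalLE_reverse]

lemma CausalLE.mono {Ω Ω' : Set M} (hΩ : Ω ⊆ Ω') {p q : M} (h : g.CausalLE Ω p q) :
    g.CausalLE Ω' p q :=
  Relation.ReflTransGen.mono (fun _ _ ⟨γ, a, b, h1, h2, h3⟩ =>
    ⟨γ, a, b, h1, fun t ht => hΩ (h2 t ht), h3⟩) _ _ h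

lemma IsInextensibleTimelike.reverse {Ω : Set M} {γ : ℝ → M}
    (h : g.IsInextensibleTimelike Ω γ) :
    g.reverse.IsInextensibleTimelike Ω (fun t => γ (-t)) := by
  obtain ⟨h1, h2, h3, h4⟩ := h
  refine ⟨fun t => h1 _, fun t => ?_, ?_, ?_⟩
  · obtain ⟨ε, hε, ha, hb⟩ := h2 (-t)
    refine ⟨ε, hε, ?_, ?_⟩
    · convert hb.reverse using 1 <;> ring
    · convert ha.reverse using 1 <;> ring
  · rintro ⟨p, hp, hlim⟩
    exact h4 ⟨p, hp, by simpa [Function.comp_def] using hlim.comp tendsto_neg_atBot_atTop⟩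
  · rintro ⟨p, hp, hlim⟩
    exact h3 ⟨p, hp, by simpa [Function.comp_def] using hlim.comp tendsto_neg_atTop_atBot⟩

lemma IsCauchyHypersurface.reverse {Ω S : Set M} (h : g.IsCauchyHypersurface Ω S) :
    g.reverse.IsCauchyHypersurface Ω S := by
  refine ⟨h.1, fun γ hγ => ?_⟩
  have h1 := hγ.reverse
  rw [reverse_reverse] at h1
  obtain ⟨t, ht, hu⟩ := h.2 _ h1
  exact ⟨-t, ht, fun s hs => by rw [← hu (-s) (by simpa using hs), neg_neg]⟩

end SpacetimeStructure

end Arcs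

/-! ### Causal cones of Lorentz forms on a vector space -/

section LorentzCones

variable {W : Type*} [NormedAddCommGroup W] [NormedSpace ℝ W]

/-- The orthogonal complement of any timelike vector of a Lorentz form is positive definite: a
plane on which the form is negative semidefinite meets the complement of the vector `v₀` that
witnesses the signature. -/
lemma pos_of_orthogonal_timelike (B : W →L[ℝ] W →L[ℝ] ℝ) (hs : ∀ v w, B v w = B w v)
    (hB : ∃ v₀, B v₀ v₀ < 0 ∧ ∀ w, w ≠ 0 → B v₀ w = 0 → 0 < B w w)
    {e v : W} (he : B e e < 0) (hv : v ≠ 0) (hev : B e v = 0) : 0 < B v v := by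
  obtain ⟨v₀, -, h₀⟩ := hB
  by_contra hneg
  push Not at hneg
  set u := B v₀ v • e - B v₀ e • v with hu
  have hu0 : B v₀ u = 0 := by simp [hu]; ring
  have huu : B u u = (B v₀ v) ^ 2 * B e e + (B v₀ e) ^ 2 * B v v := by
    simp [hu, hev, hs v e]; ring
  have hu' : u = 0 := by
    by_contra hne
    have := h₀ u hne hu0
    nlinarith [sq_nonneg (B v₀ v), sq_nonneg (B v₀ e)]
  have h1 : B e u = B v₀ v * B e e := by simp [hu, hev]
  rw [hu', map_zero] at h1
  have h2 : B v₀ v = 0 := by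
    rcases mul_eq_zero.1 h1.symm with h | h
    · exact h
    · exact absurd h he.ne
  exact absurd (h₀ v hv h2) (not_lt.2 hneg)

variable [FiniteDimensional ℝ W]

/-- The pointwise shape of the causal cones of a Lorentz form `h y` depending smoothly on `y`:
near `y₀`, causal vectors make a uniformly large product with `e = X y₀`, and the sign of that
product decides which causal vectors are future-directed. -/
lemma eventually_causal_cone {h : W → W →L[ℝ] W →L[ℝ] ℝ} {X : W → W} {y₀ : W}
    (hc : ContinuousAt h y₀) (hX : ContinuousAt X y₀) (hs : ∀ v w, h y₀ v w = h y₀ w v)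
    (hB : ∃ v₀, h y₀ v₀ v₀ < 0 ∧ ∀ w, w ≠ 0 → h y₀ v₀ w = 0 → 0 < h y₀ w w)
    (he : h y₀ (X y₀) (X y₀) < 0) :
    ∃ c > 0, ∀ᶠ y in 𝓝 y₀, ∀ v : W,
      (h y v v ≤ 0 → h y (X y) v < 0 → h y₀ (X y₀) v ≤ -c * ‖v‖) ∧
      (v ≠ 0 → h y v v ≤ 0 → h y₀ (X y₀) v ≤ 0 → h y (X y) v < 0) := by
  have hcomp : IsCompact (Metric.sphere (0 : W) 1) := isCompact_sphere 0 1
  set T : Set W := Metric.sphere (0 : W) 1 ∩ {v | h y₀ v v ≤ 0 ∧ h y₀ (X y₀) v ≤ 0} with hT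
  have hTc : IsCompact T := by
    refine hcomp.inter_right ?_
    have hq : Continuous fun v => h y₀ v v := by fun_prop
    have hl : Continuous fun v => h y₀ (X y₀) v := by fun_prop
    exact (isClosed_le hq continuous_const).inter (isClosed_le hl continuous_const)
  have hneg : ∀ v ∈ Metric.sphere (0 : W) 1, h y₀ v v ≤ 0 → h y₀ (X y₀) v ≤ 0 →
      h y₀ (X y₀) v < 0 := by
    intro v hv h1 h2
    refine lt_of_le_of_ne h2 fun h3 => ?_
    have hv0 : v ≠ 0 := ne_zero_of_mem_unit_sphere ⟨v, hv⟩
    exact absurd (pos_of_orthogonal_timelike _ hs hB he hv0 h3) (not_lt.2 h1)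
  obtain ⟨c, hc0, hcT⟩ := hTc.exists_forall_le' (f := fun v => -(h y₀ (X y₀) v)) (a := 0)
    (by fun_prop) (fun v hv => by have := hneg v hv.1 hv.2.1 hv.2.2; linarith)
  have hc1 : ∀ v : W, ContinuousAt (fun p : W × W => h p.1 p.2 p.2) (y₀, v) := fun v =>
    ((hc.comp (x := (y₀, v)) continuousAt_fst).clm_apply continuousAt_snd).clm_apply continuousAt_snd
  have hc2 : ∀ v : W, ContinuousAt (fun p : W × W => h p.1 (X p.1) p.2) (y₀, v) := fun v =>
    ((hc.comp (x := (y₀, v)) continuousAt_fst).clm_apply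
      (hX.comp (x := (y₀, v)) continuousAt_fst)).clm_apply continuousAt_snd
  have hc3 : ∀ v : W, ContinuousAt (fun p : W × W => h y₀ (X y₀) p.2) (y₀, v) := fun v => by
    fun_prop
  have E1 : ∀ᶠ y in 𝓝 y₀, ∀ v ∈ Metric.sphere (0 : W) 1,
      0 < h y v v ∨ 0 < h y (X y) v ∨ h y₀ (X y₀) v < -(c / 2) := by
    refine hcomp.eventually_forall_of_forall_eventually fun v hv => ?_
    by_cases h1 : 0 < h y₀ v v
    · exact ((hc1 v).eventually_const_lt h1).mono fun p hp => Or.inl hp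
    by_cases h2 : 0 < h y₀ (X y₀) v
    · exact ((hc2 v).eventually_const_lt h2).mono fun p hp => Or.inr (Or.inl hp)
    have h3 : h y₀ (X y₀) v < -(c / 2) := by
      have := hcT v ⟨hv, not_lt.1 h1, not_lt.1 h2⟩
      linarith
    exact ((hc3 v).eventually_lt_const h3).mono fun p hp => Or.inr (Or.inr hp)
  have E2 : ∀ᶠ y in 𝓝 y₀, ∀ v ∈ Metric.sphere (0 : W) 1,
      0 < h y v v ∨ 0 < h y₀ (X y₀) v ∨ h y (X y) v < 0 := by
    refine hcomp.eventually_forall_of_forall_eventually fun v hv => ?_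
    by_cases h1 : 0 < h y₀ v v
    · exact ((hc1 v).eventually_const_lt h1).mono fun p hp => Or.inl hp
    by_cases h2 : 0 < h y₀ (X y₀) v
    · exact ((hc3 v).eventually_const_lt h2).mono fun p hp => Or.inr (Or.inl hp)
    exact ((hc2 v).eventually_lt_const (hneg v hv (not_lt.1 h1) (not_lt.1 h2))).mono
      fun p hp => Or.inr (Or.inr hp)
  -- by homogeneity it suffices to look at unit vectors
  have hunit : ∀ v : W, v ≠ 0 → ‖v‖⁻¹ • v ∈ Metric.sphere (0 : W) 1 := fun v hv => by
    simp [norm_smul, norm_ne_zero_iff.2 hv]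
  refine ⟨c / 2, half_pos hc0, ?_⟩
  filter_upwards [E1, E2] with y h1 h2 v
  rcases eq_or_ne v 0 with rfl | hv
  · simp
  have hpos : 0 < ‖v‖⁻¹ := inv_pos.2 (norm_pos_iff.2 hv)
  have hmul : ‖v‖⁻¹ * ‖v‖ = 1 := inv_mul_cancel₀ (norm_ne_zero_iff.2 hv)
  have k1 := h1 _ (hunit v hv)
  have k2 := h2 _ (hunit v hv)
  simp only [map_smul, smul_apply, smul_eq_mul, mul_pos_iff_of_pos_left hpos] at k1 k2
  refine ⟨fun ha hb => ?_, fun _ ha hb => ?_⟩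
  · rcases k1 with k | k | k
    · exact absurd k (not_lt.2 ha)
    · exact absurd k (not_lt.2 hb.le)
    · have : ‖v‖ * (‖v‖⁻¹ * h y₀ (X y₀) v) ≤ ‖v‖ * (-(c / 2)) :=
        mul_le_mul_of_nonneg_left k.le (norm_nonneg v)
      rw [← mul_assoc, mul_comm ‖v‖, hmul, one_mul] at this
      linarith
  · rcases k2 with k | k | k
    · exact absurd k (not_lt.2 ha)
    · exact absurd k (not_lt.2 hb)
    · by_contra hcon
      exact absurd k (not_lt.2 (mul_nonneg hpos.le (not_lt.1 hcon)))

/-- The affine map `y ↦ y - δ (1 - C τ(y - y₀)) e`, where `τ = -h(y₀)(e, ·)`. It pushes points into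
the past by an amount that shrinks along future-directed curves. -/
def pastPush (e : W) (τ : W →L[ℝ] ℝ) (C : ℝ) (y₀ : W) (δ : ℝ) (y : W) : W :=
  y - (δ * (1 - C * τ (y - y₀))) • e

/-- For a Lorentz form with Lipschitz coefficients and a suitable `C`, the map `pastPush` with any
small `δ > 0` turns causal vectors into timelike ones: the change of the form between a point and
its image is of order `δ`, and it is outweighed by the term `δ C τ(v) e` that the differential of
the map adds to `v`. -/
lemma exists_pastPush {h : W → W →L[ℝ] W →L[ℝ] ℝ} {X : W → W} {y₀ : W}
    (hd : ContDiffAt ℝ 1 h y₀) (hX : ContinuousAt X y₀)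
    (hs : ∀ᶠ y in 𝓝 y₀, ∀ v w, h y v w = h y w v)
    (hB : ∃ v₀, h y₀ v₀ v₀ < 0 ∧ ∀ w, w ≠ 0 → h y₀ v₀ w = 0 → 0 < h y₀ w w)
    (he : h y₀ (X y₀) (X y₀) < 0) {N : Set W} (hN : N ∈ 𝓝 y₀) :
    ∃ (τ : W →L[ℝ] ℝ) (C R η : ℝ), 0 < R ∧ 0 < η ∧ Metric.ball y₀ R ⊆ N ∧
      (∀ y ∈ Metric.ball y₀ R, ∀ u, ‖u - X y₀‖ < η → h y u u < 0 ∧ h y (X y) u < 0) ∧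
      (∀ y ∈ Metric.ball y₀ R, 1 / 2 ≤ 1 - C * τ (y - y₀) ∧ 1 - C * τ (y - y₀) ≤ 3 / 2) ∧
      (∀ δ > 0, ∀ y ∈ Metric.ball y₀ R,
        pastPush (X y₀) τ C y₀ δ y ∈ Metric.ball y₀ R → ∀ v, h y v v ≤ 0 → h y (X y) v < 0 →
        h (pastPush (X y₀) τ C y₀ δ y) (v + (δ * C * τ v) • X y₀)
          (v + (δ * C * τ v) • X y₀) < 0 ∧
        h (pastPush (X y₀) τ C y₀ δ y) (X (pastPush (X y₀) τ C y₀ δ y))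
          (v + (δ * C * τ v) • X y₀) < 0) := by
  obtain ⟨c, hc0, hcone⟩ := eventually_causal_cone hd.continuousAt hX hs.self_of_nhds hB he
  obtain ⟨K, Nl, hNl, hK⟩ := hd.exists_lipschitzOnWith
  set e := X y₀ with hee
  set τ : W →L[ℝ] ℝ := -(h y₀ e) with hτ
  have hτv : ∀ v, τ v = -(h y₀ e v) := fun v => rfl
  set C : ℝ := (2 * K * ‖e‖ + 1) / c ^ 2 with hC
  have hC0 : 0 < C := by positivity
  have hCc : C * c ^ 2 = 2 * K * ‖e‖ + 1 := by rw [hC]; field_simp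
  -- vectors close to `e` are timelike and future-directed near `y₀`
  have hcont : ContinuousAt (fun p : W × W => h p.1 p.2 p.2) (y₀, e) :=
    ((hd.continuousAt.comp (x := (y₀, e)) continuousAt_fst).clm_apply continuousAt_snd).clm_apply
      continuousAt_snd
  have hcont' : ContinuousAt (fun p : W × W => h p.1 (X p.1) p.2) (y₀, e) :=
    ((hd.continuousAt.comp (x := (y₀, e)) continuousAt_fst).clm_apply
      (hX.comp (x := (y₀, e)) continuousAt_fst)).clm_apply continuousAt_snd
  have hev := (hcont.eventually_lt_const he).and (hcont'.eventually_lt_const he)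
  obtain ⟨η, hη, hη'⟩ := Metric.eventually_nhds_iff_ball.1 hev
  rw [← ball_prod_same] at hη'
  obtain ⟨R₁, hR₁, hball⟩ := Metric.mem_nhds_iff.1
    (Filter.inter_mem hN (Filter.inter_mem hNl (hcone.and hs)))
  set R := min (min R₁ η) (min (c / (2 * (K * ‖e‖ + 1))) (1 / (2 * (C * ‖τ‖ + 1)))) with hR
  have hR0 : 0 < R := by positivity
  have hRR₁ : R ≤ R₁ := (min_le_left _ _).trans (min_le_left _ _)
  have hRη : R ≤ η := (min_le_left _ _).trans (min_le_right _ _)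
  have hRK : R * (K * ‖e‖) ≤ c / 2 := by
    have h1 : R ≤ c / (2 * (K * ‖e‖ + 1)) := (min_le_right _ _).trans (min_le_left _ _)
    rw [le_div_iff₀ (by positivity)] at h1
    linarith
  have hRC : R * (C * ‖τ‖) ≤ 1 / 2 := by
    have h1 : R ≤ 1 / (2 * (C * ‖τ‖ + 1)) := (min_le_right _ _).trans (min_le_right _ _)
    rw [le_div_iff₀ (by positivity)] at h1
    linarith
  have hsub := (Metric.ball_subset_ball hRR₁).trans hball
  have hbd : ∀ y ∈ Metric.ball y₀ R, 1 / 2 ≤ 1 - C * τ (y - y₀) ∧ 1 - C * τ (y - y₀) ≤ 3 / 2 := by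
    intro y hy
    have h1 : ‖τ (y - y₀)‖ ≤ ‖τ‖ * R := by
      refine (τ.le_opNorm _).trans (mul_le_mul_of_nonneg_left ?_ (norm_nonneg _))
      rw [← dist_eq_norm]; exact (Metric.mem_ball.1 hy).le
    rw [Real.norm_eq_abs] at h1
    have h2 : |C * τ (y - y₀)| ≤ 1 / 2 := by
      rw [abs_mul, abs_of_pos hC0]
      nlinarith
    constructor <;> linarith [abs_le.1 h2]
  refine ⟨τ, C, R, η, hR0, hη, fun y hy => (hsub hy).1, fun y hy u hu => ?_, hbd, ?_⟩
  · exact hη' (y, u) ⟨Metric.ball_subset_ball hRη hy, by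
      rw [Metric.mem_ball, dist_eq_norm]; exact hu⟩
  intro δ hδ y hy hy' v hv hXv
  set y' := pastPush e τ C y₀ δ y with hy'def
  have hτpos : c * ‖v‖ ≤ τ v := by
    have := ((hsub hy).2.2.1 v).1 hv hXv
    rw [hτv]; linarith
  have hv0 : v ≠ 0 := by rintro rfl; simp at hXv
  have hvpos : 0 < ‖v‖ := norm_pos_iff.2 hv0
  have hτ0 : 0 < τ v := lt_of_lt_of_le (by positivity) hτpos
  have hlip : ∀ a ∈ Metric.ball y₀ R, ∀ b ∈ Metric.ball y₀ R, ∀ u w,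
      h a u w ≤ h b u w + K * ‖a - b‖ * ‖u‖ * ‖w‖ := by
    intro a ha b hb u w
    have h1 : ‖h a - h b‖ ≤ K * ‖a - b‖ := by
      have := hK.dist_le_mul a (hsub ha).2.1 b (hsub hb).2.1
      rwa [dist_eq_norm, dist_eq_norm] at this
    have h2 : ‖(h a - h b) u w‖ ≤ ‖h a - h b‖ * ‖u‖ * ‖w‖ := (h a - h b).le_opNorm₂ u w
    have h3 : (h a - h b) u w = h a u w - h b u w := rfl
    rw [h3] at h2
    have h4 : ‖h a - h b‖ * ‖u‖ * ‖w‖ ≤ K * ‖a - b‖ * ‖u‖ * ‖w‖ := by gcongr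
    linarith [le_abs_self (h a u w - h b u w), Real.norm_eq_abs (h a u w - h b u w)]
  have hyy' : ‖y' - y‖ ≤ 3 / 2 * δ * ‖e‖ := by
    have : y' - y = -((δ * (1 - C * τ (y - y₀))) • e) := by simp [hy'def, pastPush]
    rw [this, norm_neg, norm_smul, Real.norm_eq_abs, abs_mul, abs_of_pos hδ,
      abs_of_nonneg (by linarith [(hbd y hy).1])]
    have := (hbd y hy).2
    have h3 : δ * (1 - C * τ (y - y₀)) ≤ 3 / 2 * δ := by nlinarith
    exact mul_le_mul_of_nonneg_right h3 (norm_nonneg e)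
  have hy₀ : y₀ ∈ Metric.ball y₀ R := Metric.mem_ball_self hR0
  have k1 : h y' v v ≤ K * (3 / 2 * δ * ‖e‖) * ‖v‖ * ‖v‖ := by
    have h1 := hlip y' hy' y hy v v
    have h2 : K * ‖y' - y‖ * ‖v‖ * ‖v‖ ≤ K * (3 / 2 * δ * ‖e‖) * ‖v‖ * ‖v‖ := by gcongr
    linarith
  have k2 : h y' e v ≤ -(c / 2) * ‖v‖ := by
    have h1 := hlip y' hy' y₀ hy₀ e v
    have h2 : ‖y' - y₀‖ ≤ R := by rw [← dist_eq_norm]; exact (Metric.mem_ball.1 hy').le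
    have h3 : K * ‖y' - y₀‖ * ‖e‖ * ‖v‖ ≤ K * R * ‖e‖ * ‖v‖ := by gcongr
    have h4 : K * R * ‖e‖ * ‖v‖ ≤ c / 2 * ‖v‖ := by
      refine mul_le_mul_of_nonneg_right ?_ hvpos.le
      linarith
    have h5 : h y₀ e v = -τ v := by rw [hτv]; ring
    linarith
  have k3 : h y' e e < 0 := (hη' (y', e) ⟨Metric.ball_subset_ball hRη hy',
    Metric.mem_ball_self hη⟩).1
  set s := δ * C * τ v with hsdef
  have hs0 : 0 < s := by positivity
  have hexp : h y' (v + s • e) (v + s • e) = h y' v v + 2 * s * h y' e v + s ^ 2 * h y' e e := by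
    simp only [map_add, map_smul, add_apply, smul_apply, smul_eq_mul]
    rw [(hsub hy').2.2.2 v e]; ring
  have htl : h y' (v + s • e) (v + s • e) < 0 := by
    rw [hexp]
    have h1 : s ^ 2 * h y' e e ≤ 0 := mul_nonpos_of_nonneg_of_nonpos (sq_nonneg s) k3.le
    have h2 : 2 * s * h y' e v ≤ 2 * s * (-(c / 2) * ‖v‖) :=
      mul_le_mul_of_nonneg_left k2 (by positivity)
    have h3 : δ * C * (c * ‖v‖) * (c * ‖v‖) ≤ s * (c * ‖v‖) := by
      refine mul_le_mul_of_nonneg_right ?_ (by positivity)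
      exact mul_le_mul_of_nonneg_left hτpos (by positivity)
    have h4 : δ * C * (c * ‖v‖) * (c * ‖v‖) = δ * ‖v‖ ^ 2 * (2 * K * ‖e‖ + 1) := by
      rw [← hCc]; ring
    have h5 : 0 < δ * ‖v‖ ^ 2 := by positivity
    have h6 : 0 ≤ δ * ‖v‖ ^ 2 * (K * ‖e‖) := by positivity
    have h7 : K * (3 / 2 * δ * ‖e‖) * ‖v‖ * ‖v‖ = 3 / 2 * (δ * ‖v‖ ^ 2 * (K * ‖e‖)) := by ring
    have h8 : 2 * s * (-(c / 2) * ‖v‖) = -(s * (c * ‖v‖)) := by ring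
    have h9 : δ * ‖v‖ ^ 2 * (2 * K * ‖e‖ + 1) = 2 * (δ * ‖v‖ ^ 2 * (K * ‖e‖)) + δ * ‖v‖ ^ 2 := by
      ring
    linarith only [h1, h2, h3, h4, h5, h6, h7, h8, h9, k1]
  refine ⟨htl, ?_⟩
  have hτ' : h y₀ e (v + s • e) < 0 := by
    simp only [map_add, map_smul, smul_eq_mul]
    have h1 : h y₀ e v = -τ v := by rw [hτv]; ring
    have h2 : s * h y₀ e e < 0 := mul_neg_of_pos_of_neg hs0 he
    linarith only [h1, h2, hτ0]
  refine ((hsub hy').2.2.1 _).2 ?_ htl.le hτ'.le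
  intro h0
  rw [h0] at htl
  simp at htl

end LorentzCones

/-! ### The metric in local coordinates -/

section Charts

variable {m : ℕ} {M : Type*} [TopologicalSpace M] [ChartedSpace (E m) M]
  [IsManifold (𝓡 m) ∞ M]

namespace SpacetimeStructure

variable (g : SpacetimeStructure m M)

/-- The coefficients of the metric in the coordinates around `z`. -/
def chartMetric (z : M) (y : E m) : E m →L[ℝ] E m →L[ℝ] ℝ :=
  (trivializationAt (E m →L[ℝ] E m →L[ℝ] ℝ)
    (fun x : M => TangentSpace (𝓡 m) x →L[ℝ] TangentSpace (𝓡 m) x →L[ℝ] ℝ) z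
    (TotalSpace.mk' (E m →L[ℝ] E m →L[ℝ] ℝ)
      (E := fun x : M => TangentSpace (𝓡 m) x →L[ℝ] TangentSpace (𝓡 m) x →L[ℝ] ℝ)
      ((extChartAt (𝓡 m) z).symm y) (g.metric ((extChartAt (𝓡 m) z).symm y)))).2

/-- The time orientation in the coordinates around `z`. -/
def chartField (z : M) (y : E m) : E m :=
  (trivializationAt (E m) (fun x : M => TangentSpace (𝓡 m) x) z
    (TotalSpace.mk' (E m) (E := fun x : M => TangentSpace (𝓡 m) x)
      ((extChartAt (𝓡 m) z).symm y) (g.timeField ((extChartAt (𝓡 m) z).symm y)))).2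

lemma contDiffAt_chartMetric (z : M) :
    ContDiffAt ℝ 1 (g.chartMetric z) (extChartAt (𝓡 m) z z) := by
  have h1 := g.metric_smooth z
  rw [contMDiffAt_section] at h1
  have h2 : ContMDiffAt 𝓘(ℝ, E m) (𝓡 m) ∞ (extChartAt (𝓡 m) z).symm (extChartAt (𝓡 m) z z) :=
    (contMDiffOn_extChartAt_symm z).contMDiffAt (extChartAt_target_mem_nhds z)
  have h3 := ContMDiffAt.comp_of_eq h1 h2 (by simp)
  exact h3.contDiffAt.of_le (by simp)

lemma continuousAt_chartField (z : M) :
    ContinuousAt (g.chartField z) (extChartAt (𝓡 m) z z) := by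
  have h1 := g.timeField_smooth z
  rw [contMDiffAt_section] at h1
  have h2 : ContMDiffAt 𝓘(ℝ, E m) (𝓡 m) ∞ (extChartAt (𝓡 m) z).symm (extChartAt (𝓡 m) z z) :=
    (contMDiffOn_extChartAt_symm z).contMDiffAt (extChartAt_target_mem_nhds z)
  have h3 := ContMDiffAt.comp_of_eq h1 h2 (by simp)
  exact h3.continuousAt

/-- The tangent vector at `x` with coordinates `v` in the chart around `z`. -/
abbrev ofCoord (z x : M) : E m →L[ℝ] TangentSpace (𝓡 m) x :=
  (trivializationAt (E m) (fun x : M => TangentSpace (𝓡 m) x) z).symmL ℝ x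

/-- The coordinates of a tangent vector at `x` in the chart around `z`. -/
abbrev toCoord (z x : M) : TangentSpace (𝓡 m) x →L[ℝ] E m :=
  (trivializationAt (E m) (fun x : M => TangentSpace (𝓡 m) x) z).continuousLinearMapAt ℝ x

variable {z : M} {y : E m}

lemma mem_baseSet_of_mem_target (hy : y ∈ (extChartAt (𝓡 m) z).target) :
    (extChartAt (𝓡 m) z).symm y ∈
      (trivializationAt (E m) (fun x : M => TangentSpace (𝓡 m) x) z).baseSet := by
  have := (extChartAt (𝓡 m) z).map_target hy
  rw [extChartAt_source] at this
  simpa using this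

lemma chartMetric_apply (hy : y ∈ (extChartAt (𝓡 m) z).target) (v w : E m) :
    g.chartMetric z y v w = g.metric _ (ofCoord z ((extChartAt (𝓡 m) z).symm y) v)
      (ofCoord z ((extChartAt (𝓡 m) z).symm y) w) := by
  have hb := mem_baseSet_of_mem_target hy
  rw [chartMetric, hom_trivializationAt_apply]
  refine (inCoordinates_apply_eq₂ hb hb (mem_univ _)).trans ?_
  rw [ofCoord, Trivialization.symmL_apply _ hb, Trivialization.symmL_apply _ hb,
    Trivialization.coe_linearMapAt_of_mem _ (mem_univ _)]
  rfl

lemma chartField_apply (hy : y ∈ (extChartAt (𝓡 m) z).target) :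
    g.chartField z y = toCoord z _ (g.timeField ((extChartAt (𝓡 m) z).symm y)) := by
  have hb := mem_baseSet_of_mem_target hy
  rw [toCoord, Trivialization.continuousLinearMapAt_apply,
    Trivialization.coe_linearMapAt_of_mem _ hb]
  rfl

lemma ofCoord_toCoord (hy : y ∈ (extChartAt (𝓡 m) z).target)
    (v : TangentSpace (𝓡 m) ((extChartAt (𝓡 m) z).symm y)) :
    ofCoord z _ (toCoord z _ v) = v :=
  Trivialization.symmL_continuousLinearMapAt _ (mem_baseSet_of_mem_target hy) v

lemma toCoord_ofCoord (hy : y ∈ (extChartAt (𝓡 m) z).target) (v : E m) :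
    toCoord z ((extChartAt (𝓡 m) z).symm y) (ofCoord z _ v) = v :=
  Trivialization.continuousLinearMapAt_symmL _ (mem_baseSet_of_mem_target hy) v

lemma chartMetric_symm (hy : y ∈ (extChartAt (𝓡 m) z).target) (v w : E m) :
    g.chartMetric z y v w = g.chartMetric z y w v := by
  rw [chartMetric_apply g hy, chartMetric_apply g hy, g.metric_symm]

lemma chartMetric_lorentz (hy : y ∈ (extChartAt (𝓡 m) z).target) :
    ∃ v₀, g.chartMetric z y v₀ v₀ < 0 ∧
      ∀ w, w ≠ 0 → g.chartMetric z y v₀ w = 0 → 0 < g.chartMetric z y w w := by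
  obtain ⟨v, hv, hpos⟩ := g.metric_lorentz ((extChartAt (𝓡 m) z).symm y)
  refine ⟨toCoord z _ v, ?_, fun w hw h0 => ?_⟩
  · rw [chartMetric_apply g hy, ofCoord_toCoord hy]
    exact hv
  · rw [chartMetric_apply g hy] at h0 ⊢
    rw [ofCoord_toCoord hy] at h0
    refine hpos _ (fun h => hw ?_) h0
    rw [← toCoord_ofCoord hy w, h, map_zero]

lemma chartField_timelike (hy : y ∈ (extChartAt (𝓡 m) z).target) :
    g.chartMetric z y (g.chartField z y) (g.chartField z y) < 0 := by
  rw [chartMetric_apply g hy, chartField_apply g hy, ofCoord_toCoord hy]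
  exact g.timeField_timelike _

lemma futureCausal_ofCoord (hy : y ∈ (extChartAt (𝓡 m) z).target) (v : E m) :
    g.FutureCausal (ofCoord z ((extChartAt (𝓡 m) z).symm y) v) ↔
      g.chartMetric z y v v ≤ 0 ∧ g.chartMetric z y (g.chartField z y) v < 0 := by
  rw [chartMetric_apply g hy, chartMetric_apply g hy, chartField_apply g hy, ofCoord_toCoord hy]
  rfl

lemma futureTimelike_ofCoord (hy : y ∈ (extChartAt (𝓡 m) z).target) (v : E m) :
    g.FutureTimelike (ofCoord z ((extChartAt (𝓡 m) z).symm y) v) ↔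
      g.chartMetric z y v v < 0 ∧ g.chartMetric z y (g.chartField z y) v < 0 := by
  rw [chartMetric_apply g hy, chartMetric_apply g hy, chartField_apply g hy, ofCoord_toCoord hy]
  rfl

variable {γ : ℝ → M} {η : ℝ → E m} {a b t : ℝ}

/-- The velocity of a curve given in coordinates. -/
lemma velocity_symm_comp (hab : a < b) (hη : ContDiffOn ℝ 1 η (Icc a b))
    (hm : ∀ t ∈ Icc a b, η t ∈ (extChartAt (𝓡 m) z).target) (ht : t ∈ Icc a b) :
    velocity (m := m) (fun t => (extChartAt (𝓡 m) z).symm (η t)) a b t =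
      ofCoord z ((extChartAt (𝓡 m) z).symm (η t)) (derivWithin η (Icc a b) t) := by
  have hu : UniqueMDiffWithinAt 𝓘(ℝ, ℝ) (Icc a b) t :=
    (uniqueDiffOn_Icc hab t ht).uniqueMDiffWithinAt
  have hd : MDifferentiableWithinAt 𝓘(ℝ, ℝ) 𝓘(ℝ, E m) η (Icc a b) t :=
    ((hη t ht).differentiableWithinAt one_ne_zero).mdifferentiableWithinAt
  have hs : MDifferentiableWithinAt 𝓘(ℝ, E m) (𝓡 m) (extChartAt (𝓡 m) z).symm
      (range (𝓡 m)) (η t) := by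
    have := mdifferentiableWithinAt_extChartAt_symm (I := 𝓡 m) (hm t ht)
    exact this
  have h1 := mfderivWithin_comp t hs hd (by intro s _; simp) hu
  have hsrc : (extChartAt (𝓡 m) z).symm (η t) ∈ (chartAt (E m) z).source := by
    have := (extChartAt (𝓡 m) z).map_target (hm t ht)
    rwa [extChartAt_source] at this
  have h2 := TangentBundle.symmL_trivializationAt (I := 𝓡 m) hsrc
  rw [(extChartAt (𝓡 m) z).right_inv (hm t ht)] at h2
  have h3 := congrArg (fun L => L (1 : ℝ)) h1
  refine h3.trans ?_
  rw [ofCoord, h2]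
  have h4 : mfderivWithin 𝓘(ℝ, ℝ) 𝓘(ℝ, E m) η (Icc a b) t (1 : ℝ) =
      derivWithin η (Icc a b) t := by
    rw [mfderivWithin_eq_fderivWithin]; rfl
  rw [← h4]
  rfl

lemma isTimelikeArc_symm_comp (hab : a < b) (hη : ContDiffOn ℝ 1 η (Icc a b))
    (hm : ∀ t ∈ Icc a b, η t ∈ (extChartAt (𝓡 m) z).target)
    (h : ∀ t ∈ Icc a b,
      g.chartMetric z (η t) (derivWithin η (Icc a b) t) (derivWithin η (Icc a b) t) < 0 ∧
      g.chartMetric z (η t) (g.chartField z (η t)) (derivWithin η (Icc a b) t) < 0) :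
    g.IsTimelikeArc (fun t => (extChartAt (𝓡 m) z).symm (η t)) a b := by
  refine ⟨hab, ?_, fun t ht => ?_⟩
  · have h1 : ContMDiffOn 𝓘(ℝ, E m) (𝓡 m) 1 (extChartAt (𝓡 m) z).symm
        (extChartAt (𝓡 m) z).target :=
      (contMDiffOn_extChartAt_symm (n := ∞) z).of_le (by simp)
    exact h1.comp hη.contMDiffOn hm
  · rw [velocity_symm_comp hab hη hm ht, futureTimelike_ofCoord g (hm t ht)]
    exact h t ht

/-- The coordinate expression of a causal arc. -/
lemma IsCausalArc.chart {g : SpacetimeStructure m M} (h : g.IsCausalArc γ a b)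
    (hm : ∀ t ∈ Icc a b, γ t ∈ (extChartAt (𝓡 m) z).source) :
    ContDiffOn ℝ 1 (fun t => extChartAt (𝓡 m) z (γ t)) (Icc a b) ∧ ∀ t ∈ Icc a b,
      g.chartMetric z (extChartAt (𝓡 m) z (γ t))
        (derivWithin (fun t => extChartAt (𝓡 m) z (γ t)) (Icc a b) t)
        (derivWithin (fun t => extChartAt (𝓡 m) z (γ t)) (Icc a b) t) ≤ 0 ∧
      g.chartMetric z (extChartAt (𝓡 m) z (γ t)) (g.chartField z (extChartAt (𝓡 m) z (γ t)))
        (derivWithin (fun t => extChartAt (𝓡 m) z (γ t)) (Icc a b) t) < 0 := by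
  have h1 : ContMDiffOn (𝓡 m) 𝓘(ℝ, E m) 1 (extChartAt (𝓡 m) z) (extChartAt (𝓡 m) z).source := by
    rw [extChartAt_source]
    exact (contMDiffOn_extChartAt (n := ∞)).of_le (by simp)
  have hη : ContDiffOn ℝ 1 (fun t => extChartAt (𝓡 m) z (γ t)) (Icc a b) :=
    (h1.comp h.2.1 hm).contDiffOn
  refine ⟨hη, fun t ht => ?_⟩
  have hm' : ∀ t ∈ Icc a b, extChartAt (𝓡 m) z (γ t) ∈ (extChartAt (𝓡 m) z).target :=
    fun t ht => (extChartAt (𝓡 m) z).map_source (hm t ht)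
  rw [← futureCausal_ofCoord g (hm' t ht), ← velocity_symm_comp h.1 hη hm' ht]
  have h2 : IsArc (fun _ v => g.FutureCausal v)
      (fun t => (extChartAt (𝓡 m) z).symm (extChartAt (𝓡 m) z (γ t))) a b :=
    IsArc.congr h fun t ht => (extChartAt (𝓡 m) z).left_inv (hm t ht)
  exact h2.2.2 t ht

end SpacetimeStructure

end Charts

/-! ### The chronological relation and its local structure -/

section Chronology

variable {m : ℕ} {M : Type*} [TopologicalSpace M] [ChartedSpace (E m) M]
  [IsManifold (𝓡 m) ∞ M]

namespace SpacetimeStructure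

variable (g : SpacetimeStructure m M)

/-- `q` is the end point of a future-directed timelike `C¹` arc that starts at `p`. -/
def TimelikeStep (p q : M) : Prop :=
  ∃ (γ : ℝ → M) (a b : ℝ), g.IsTimelikeArc γ a b ∧ γ a = p ∧ γ b = q

/-- The chronological relation `p ≪ q`: a future-directed timelike piecewise `C¹` curve leads from
`p` to `q`. -/
def ChronLT : M → M → Prop := Relation.TransGen g.TimelikeStep

/-- `w` is stably before `x`: the chronological relation holds between all points near `w` and all
points near `x`. -/
def StablyBefore (w x : M) : Prop := ∀ᶠ p in 𝓝 (w, x), g.ChronLT p.1 p.2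

variable {g}

lemma TimelikeStep.causalStep {p q : M} (h : g.TimelikeStep p q) : g.CausalStep univ p q := by
  obtain ⟨γ, a, b, h1, h2, h3⟩ := h
  exact ⟨γ, a, b, h1.isCausalArc, fun _ _ => mem_univ _, h2, h3⟩

lemma ChronLT.causalLE {p q : M} (h : g.ChronLT p q) : g.CausalLE univ p q :=
  Relation.TransGen.to_reflTransGen (Relation.TransGen.mono (fun _ _ => TimelikeStep.causalStep) _ _ h)

lemma ChronLT.trans {p q r : M} (h : g.ChronLT p q) (h' : g.ChronLT q r) : g.ChronLT p r :=
  Relation.TransGen.trans h h'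

lemma TimelikeStep.reverse {p q : M} (h : g.TimelikeStep p q) : g.reverse.TimelikeStep q p := by
  obtain ⟨γ, a, b, hγ, rfl, rfl⟩ := h
  exact ⟨_, _, _, hγ.reverse, by simp, by simp⟩

lemma ChronLT.reverse {p q : M} (h : g.ChronLT p q) : g.reverse.ChronLT q p := by
  induction h with
  | single h => exact .single h.reverse
  | tail _ h ih => exact .head h.reverse ih

variable (g) in
lemma chronLT_reverse {p q : M} : g.reverse.ChronLT p q ↔ g.ChronLT q p :=
  ⟨fun h => by simpa [reverse_reverse] using h.reverse, ChronLT.reverse⟩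

lemma StablyBefore.reverse {w x : M} (h : g.StablyBefore w x) : g.reverse.StablyBefore x w :=
  ((continuous_swap.tendsto (x, w)).eventually h).mono fun _ hp => hp.reverse

lemma StablyBefore.chronLT {w x : M} (h : g.StablyBefore w x) : g.ChronLT w x :=
  h.self_of_nhds

lemma StablyBefore.eventually {w x : M} (h : g.StablyBefore w x) :
    ∀ᶠ p in 𝓝 (w, x), g.StablyBefore p.1 p.2 :=
  Filter.Eventually.eventually_nhds h

lemma StablyBefore.eventually_right {w x : M} (h : g.StablyBefore w x) :
    ∀ᶠ y in 𝓝 x, g.StablyBefore w y :=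
  ((Continuous.prodMk_right w).tendsto x).eventually h.eventually

lemma StablyBefore.eventually_left {w x : M} (h : g.StablyBefore w x) :
    ∀ᶠ y in 𝓝 w, g.StablyBefore y x :=
  ((Continuous.prodMk_left x).tendsto w).eventually h.eventually

variable (g) in
/-- A neighbourhood `U` of `z` with maps `push δ` into the past, `0 ≤ δ < δ₀`, which turn causal
arcs into timelike ones, together with the existence of causal arcs that leave any compact part
of `U`. This is all that is used of the local geometry. -/
structure LocalPush (z : M) where
  /-- the neighbourhood -/
  U : Set M
  /-- the bound for the parameters -/
  δ₀ : ℝ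
  /-- the maps -/
  push : ℝ → M → M
  isOpen_U : IsOpen U
  mem_U : z ∈ U
  δ₀_pos : 0 < δ₀
  push_zero : ∀ x ∈ U, push 0 x = x
  tendsto_push : ∀ x ∈ U, Tendsto (fun δ => push δ x) (𝓝 0) (𝓝 x)
  continuousAt_push : ∀ δ, 0 ≤ δ → δ < δ₀ → ∀ x ∈ U, ContinuousAt (push δ) x
  timelikeStep_push : ∀ δ, 0 < δ → δ < δ₀ → ∀ x y, g.CausalStep U x y →
    g.TimelikeStep (push δ x) (push δ y)
  stablyBefore_push : ∀ δ δ', 0 ≤ δ → δ < δ' → δ' < δ₀ → ∀ x ∈ U,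
    g.StablyBefore (push δ' x) (push δ x)
  exists_escape : ∀ x ∈ U, ∀ L ⊆ U, IsCompact L → ∃ y ∈ U, y ∉ L ∧ g.CausalStep U x y
  exists_after : ∃ x, g.StablyBefore z x

variable (g) in
lemma nonempty_localPush (z : M) : Nonempty (g.LocalPush z) := by
  set φ := extChartAt (𝓡 m) z with hφ
  set y₀ := φ z with hy₀
  set h := g.chartMetric z with hh
  set X := g.chartField z with hXdef
  have hzt : y₀ ∈ φ.target := mem_extChartAt_target z
  have hN : φ.target ∈ 𝓝 y₀ := extChartAt_target_mem_nhds z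
  obtain ⟨τ, C, R, η, hR, hη, hball, hline, hbd, hpush⟩ := exists_pastPush
    (g.contDiffAt_chartMetric z) (g.continuousAt_chartField z)
    (by filter_upwards [hN] with y hy using g.chartMetric_symm hy)
    (g.chartMetric_lorentz hzt) (g.chartField_timelike hzt) hN
  set e := X y₀ with he
  have he0 : e ≠ 0 := by
    intro h0
    have := g.chartField_timelike hzt
    rw [← hXdef, ← he, h0] at this
    simp at this
  have henorm : 0 < ‖e‖ := norm_pos_iff.2 he0
  -- straight lines in directions close to `e` are timelike
  have hstraight : ∀ p ∈ Metric.ball y₀ R, ∀ q ∈ Metric.ball y₀ R, ∀ l : ℝ, 0 < l →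
      ‖l⁻¹ • (q - p) - e‖ < η →
      g.IsTimelikeArc (fun t => φ.symm (p + t • (l⁻¹ • (q - p)))) 0 l := by
    intro p hp q hq l hl hu
    have hmem : ∀ t ∈ Icc 0 l, p + t • (l⁻¹ • (q - p)) ∈ Metric.ball y₀ R := by
      intro t ht
      rw [smul_smul]
      refine (convex_ball y₀ R).add_smul_sub_mem hp hq ⟨mul_nonneg ht.1 (inv_nonneg.2 hl.le), ?_⟩
      rw [← div_eq_mul_inv, div_le_one hl]
      exact ht.2
    have hder : ∀ t ∈ Icc 0 l, derivWithin (fun t : ℝ => p + t • (l⁻¹ • (q - p))) (Icc 0 l) t =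
        l⁻¹ • (q - p) := by
      intro t ht
      have h1 : HasDerivAt (fun t : ℝ => p + t • (l⁻¹ • (q - p))) ((1 : ℝ) • (l⁻¹ • (q - p))) t :=
        ((hasDerivAt_id t).smul_const _).const_add p
      rw [one_smul] at h1
      exact h1.hasDerivWithinAt.derivWithin (uniqueDiffOn_Icc hl t ht)
    refine isTimelikeArc_symm_comp g hl (by fun_prop) (fun t ht => hball (hmem t ht)) ?_
    intro t ht
    rw [hder t ht]
    exact hline _ (hmem t ht) _ hu
  have hφsymm : ∀ p ∈ Metric.ball y₀ R, ContinuousAt φ.symm p := fun p hp =>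
    continuousAt_extChartAt_symm'' (hball hp)
  have hφc : ∀ p ∈ Metric.ball y₀ R, Tendsto φ (𝓝 (φ.symm p)) (𝓝 p) := fun p hp => by
    have h1 : ContinuousAt φ (φ.symm p) := by
      have := φ.map_target (hball hp)
      rw [extChartAt_source] at this
      exact continuousAt_extChartAt' (by rw [extChartAt_source]; exact this)
    rw [ContinuousAt, φ.right_inv (hball hp)] at h1
    exact h1
  have hφsrc : ∀ p ∈ Metric.ball y₀ R, ∀ᶠ x in 𝓝 (φ.symm p), x ∈ φ.source := fun p hp =>
    (isOpen_extChartAt_source z).mem_nhds (φ.map_target (hball hp))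
  have hstable : ∀ p ∈ Metric.ball y₀ R, ∀ q ∈ Metric.ball y₀ R, ∀ l : ℝ, 0 < l →
      q - p = l • e → g.StablyBefore (φ.symm p) (φ.symm q) := by
    intro p hp q hq l hl hqp
    have h1 : ∀ᶠ w : E m × E m in 𝓝 (p, q), ‖l⁻¹ • (w.2 - w.1) - e‖ < η := by
      have hc : Continuous fun w : E m × E m => ‖l⁻¹ • (w.2 - w.1) - e‖ := by fun_prop
      refine hc.continuousAt.eventually_lt_const ?_
      simp only [hqp, smul_smul, inv_mul_cancel₀ hl.ne', one_smul, sub_self, norm_zero]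
      exact hη
    have h2 : ∀ᶠ w : E m × E m in 𝓝 (p, q), w.1 ∈ Metric.ball y₀ R ∧ w.2 ∈ Metric.ball y₀ R :=
      prod_mem_nhds (Metric.isOpen_ball.mem_nhds hp) (Metric.isOpen_ball.mem_nhds hq)
    have h3 : Tendsto (fun w : M × M => (φ w.1, φ w.2)) (𝓝 (φ.symm p, φ.symm q)) (𝓝 (p, q)) := by
      rw [nhds_prod_eq, nhds_prod_eq]
      exact (hφc p hp).prodMap (hφc q hq)
    have h4 : ∀ᶠ w : M × M in 𝓝 (φ.symm p, φ.symm q), w.1 ∈ φ.source ∧ w.2 ∈ φ.source :=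
      prod_mem_nhds (hφsrc p hp) (hφsrc q hq)
    filter_upwards [h3.eventually (h1.and h2), h4] with w hw hw'
    refine .single ⟨_, _, _, hstraight _ hw.2.1 _ hw.2.2 l hl hw.1, ?_, ?_⟩
    · simp [φ.left_inv hw'.1]
    · simp only [smul_smul, mul_inv_cancel₀ hl.ne', one_smul, add_sub_cancel]
      exact φ.left_inv hw'.2
  have hRR : Metric.ball y₀ (R / 2) ⊆ Metric.ball y₀ R := Metric.ball_subset_ball (by linarith)
  have hpm : ∀ δ, 0 ≤ δ → δ < R / (3 * ‖e‖ + 1) → ∀ y ∈ Metric.ball y₀ (R / 2),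
      pastPush e τ C y₀ δ y ∈ Metric.ball y₀ R := by
    intro δ h0 hδ y hy
    rw [lt_div_iff₀ (by positivity)] at hδ
    have h1 := hbd y (hRR hy)
    have h2 : ‖(δ * (1 - C * τ (y - y₀))) • e‖ ≤ δ * (3 / 2) * ‖e‖ := by
      rw [norm_smul, Real.norm_eq_abs, abs_of_nonneg (mul_nonneg h0 (by linarith))]
      exact mul_le_mul_of_nonneg_right (mul_le_mul_of_nonneg_left h1.2 h0) henorm.le
    rw [Metric.mem_ball, dist_eq_norm] at hy ⊢
    have h3 : pastPush e τ C y₀ δ y - y₀ = (y - y₀) - (δ * (1 - C * τ (y - y₀))) • e := by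
      rw [pastPush]; abel
    rw [h3]
    have h4 := norm_sub_le (y - y₀) ((δ * (1 - C * τ (y - y₀))) • e)
    linarith
  have hpc : ∀ δ, Continuous (pastPush e τ C y₀ δ) := fun δ => by
    unfold pastPush; fun_prop
  set U : Set M := φ.source ∩ φ ⁻¹' Metric.ball y₀ (R / 2) with hU
  have hUo : IsOpen U := (continuousOn_extChartAt z).isOpen_inter_preimage
    (isOpen_extChartAt_source z) Metric.isOpen_ball
  have hymem : y₀ ∈ Metric.ball y₀ (R / 2) := Metric.mem_ball_self (by linarith)
  have hUsymm : ∀ p ∈ Metric.ball y₀ (R / 2), φ.symm p ∈ U := fun p hp =>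
    ⟨φ.map_target (hball (hRR hp)), by
      rw [mem_preimage, φ.right_inv (hball (hRR hp))]; exact hp⟩
  refine ⟨⟨U, R / (3 * ‖e‖ + 1), fun δ x => φ.symm (pastPush e τ C y₀ δ (φ x)), hUo,
    ⟨mem_extChartAt_source z, hymem⟩, by positivity, ?_, ?_, ?_, ?_, ?_, ?_, ?_⟩⟩
  · intro x hx
    simp [pastPush, φ.left_inv hx.1]
  · intro x hx
    have h1 : Continuous fun δ => pastPush e τ C y₀ δ (φ x) := by unfold pastPush; fun_prop
    have h2 : pastPush e τ C y₀ 0 (φ x) = φ x := by simp [pastPush]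
    have h3 := h1.tendsto 0
    rw [h2] at h3
    have h4 := (hφsymm (φ x) (hRR hx.2)).tendsto
    rw [φ.left_inv hx.1] at h4
    exact h4.comp h3
  · intro δ h0 hδ x hx
    have h1 : ContinuousAt φ x := continuousAt_extChartAt' hx.1
    exact (hφsymm _ (hpm δ h0 hδ _ hx.2)).tendsto.comp (((hpc δ).tendsto (φ x)).comp h1)
  · rintro δ h0 hδ x y ⟨γ, a, b, hγ, hγU, rfl, rfl⟩
    obtain ⟨hc, hv⟩ := hγ.chart (z := z) (fun t ht => (hγU t ht).1)
    refine ⟨fun t => φ.symm (pastPush e τ C y₀ δ (φ (γ t))), a, b, ?_, rfl, rfl⟩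
    have hmem : ∀ t ∈ Icc a b, pastPush e τ C y₀ δ (φ (γ t)) ∈ Metric.ball y₀ R :=
      fun t ht => hpm δ h0.le hδ _ (hγU t ht).2
    have hder : ∀ t ∈ Icc a b, derivWithin (fun t => pastPush e τ C y₀ δ (φ (γ t))) (Icc a b) t =
        derivWithin (fun t => φ (γ t)) (Icc a b) t +
          (δ * C * τ (derivWithin (fun t => φ (γ t)) (Icc a b) t)) • e := by
      intro t ht
      have hd : HasDerivWithinAt (fun t => φ (γ t)) (derivWithin (fun t => φ (γ t)) (Icc a b) t)
          (Icc a b) t := ((hc t ht).differentiableWithinAt one_ne_zero).hasDerivWithinAt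
      have hτd := (τ.hasFDerivAt (x := φ (γ t) - y₀)).comp_hasDerivWithinAt t (hd.sub_const y₀)
      have h1 := hd.sub ((((hτd.const_mul C).const_sub 1).const_mul δ).smul_const e)
      refine (h1.derivWithin (uniqueDiffOn_Icc hγ.1 t ht)).trans ?_
      rw [sub_eq_add_neg, ← neg_smul]
      congr 2
      ring
    refine isTimelikeArc_symm_comp g hγ.1 ?_ (fun t ht => hball (hmem t ht)) ?_
    · unfold pastPush
      exact hc.sub ((contDiffOn_const.mul (contDiffOn_const.sub (contDiffOn_const.mul
        (τ.contDiff.comp_contDiffOn (hc.sub contDiffOn_const))))).smul contDiffOn_const)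
    · intro t ht
      rw [hder t ht]
      exact hpush δ h0 _ (hRR (hγU t ht).2) (hmem t ht) _ (hv t ht).1 (hv t ht).2
  · intro δ δ' h0 hδ hδ' x hx
    have h1 := hbd _ (hRR hx.2)
    refine hstable _ (hpm δ' (h0.trans hδ.le) hδ' _ hx.2) _ (hpm δ h0 (hδ.trans hδ') _ hx.2)
      ((δ' - δ) * (1 - C * τ (φ x - y₀))) (mul_pos (by linarith) (by linarith)) ?_
    rw [pastPush, pastPush, sub_sub_sub_cancel_left, ← sub_smul]
    congr 1
    ring
  · intro x hx L hLU hL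
    -- the line through `x` in the direction `e` leaves a ball that contains `L`
    have hLc : IsCompact (φ '' L) :=
      hL.image_of_continuousOn ((continuousOn_extChartAt z).mono fun y hy => (hLU hy).1)
    obtain ⟨r, hr, hLr⟩ : ∃ r < R / 2, ∀ y ∈ φ '' L, dist y y₀ ≤ r := by
      have h1 := hLc.exists_forall_le' (f := fun y => -dist y y₀) (a := -(R / 2)) (by fun_prop)
        (by rintro _ ⟨y, hy, rfl⟩; exact neg_lt_neg (Metric.mem_ball.1 (hLU hy).2))
      obtain ⟨r, hr, h⟩ := h1
      exact ⟨-r, by linarith, fun y hy => by linarith [h y hy]⟩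
    have hxr : dist (φ x) y₀ < R / 2 := hx.2
    obtain ⟨s, hs1, hs2⟩ : ∃ s, max r (dist (φ x) y₀) < s ∧ s < R / 2 :=
      exists_between (max_lt hr hxr)
    have hcont : Continuous fun t : ℝ => dist (φ x + t • e) y₀ := by fun_prop
    obtain ⟨T, hT, hTs⟩ : ∃ T ∈ Icc (0 : ℝ) (R / ‖e‖), dist (φ x + T • e) y₀ = s := by
      refine intermediate_value_Icc (by positivity) hcont.continuousOn ⟨?_, ?_⟩
      · simp only [zero_smul, add_zero]
        exact ((le_max_right _ _).trans_lt hs1).le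
      · have h1 : ‖(R / ‖e‖) • e‖ = R := by
          rw [norm_smul, Real.norm_eq_abs, abs_of_pos (by positivity), div_mul_cancel₀ _ henorm.ne']
        have h2 : ‖(R / ‖e‖) • e‖ ≤ ‖φ x + (R / ‖e‖) • e - y₀‖ + ‖φ x - y₀‖ := by
          refine le_trans (le_of_eq ?_) (norm_sub_le _ _)
          congr 1; abel
        rw [h1, ← dist_eq_norm, ← dist_eq_norm] at h2
        linarith
    have hT0 : 0 < T := by
      refine lt_of_le_of_ne hT.1 fun h0 => ?_
      rw [← h0, zero_smul, add_zero] at hTs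
      exact absurd (le_max_right r (dist (φ x) y₀)) (by rw [hTs] at hs1 ⊢; exact not_le.2 hs1)
    have hq : φ x + T • e ∈ Metric.ball y₀ (R / 2) := by rw [Metric.mem_ball, hTs]; exact hs2
    have harc := hstraight (φ x) (hRR hx.2) _ (hRR hq) T hT0
      (by simp [smul_smul, inv_mul_cancel₀ hT0.ne', hη])
    simp only [add_sub_cancel_left, smul_smul, inv_mul_cancel₀ hT0.ne', one_smul] at harc
    refine ⟨φ.symm (φ x + T • e), hUsymm _ hq, fun hmem => ?_, _, 0, T, harc.isCausalArc, ?_, ?_, rfl⟩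
    · have h1 := hLr _ (mem_image_of_mem φ hmem)
      rw [φ.right_inv (hball (hRR hq)), hTs] at h1
      exact absurd ((le_max_left _ _).trans_lt hs1) (not_lt.2 h1)
    · intro t ht
      refine hUsymm _ ?_
      have h1 := (convex_ball y₀ (R / 2)).add_smul_sub_mem hx.2 hq (t := t / T)
        ⟨div_nonneg ht.1 hT0.le, (div_le_one hT0).2 ht.2⟩
      rw [add_sub_cancel_left, smul_smul, div_mul_cancel₀ _ hT0.ne'] at h1
      exact h1
    · simp [φ.left_inv hx.1]
  · have hc : Continuous fun t : ℝ => y₀ + t • e := by fun_prop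
    have h1 : ∀ᶠ t : ℝ in 𝓝[>] 0, y₀ + t • e ∈ Metric.ball y₀ R :=
      (hc.tendsto' 0 y₀ (by simp)).mono_left nhdsWithin_le_nhds
        (Metric.isOpen_ball.mem_nhds (hRR hymem))
    obtain ⟨t, ht, ht0⟩ := (h1.and self_mem_nhdsWithin).exists
    refine ⟨φ.symm (y₀ + t • e), ?_⟩
    have h2 := hstable y₀ (hRR hymem) _ ht t ht0 (by simp)
    rwa [hy₀, φ.left_inv (mem_extChartAt_source z)] at h2

end SpacetimeStructure

end Chronology

/-! ### Push-up and limits of causal curves -/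

section LocalCausality

variable {m : ℕ} {M : Type*} [TopologicalSpace M] [ChartedSpace (E m) M]
  [IsManifold (𝓡 m) ∞ M]

/-- Induction along a compact interval for a property that spreads a little to the right, and that
passes to a point from the points slightly to the left of it. -/
lemma interval_induction {Q : ℝ → Prop} {a b : ℝ} (hab : a ≤ b) (ha : Q a)
    (hr : ∀ t ∈ Ico a b, Q t → ∃ s ∈ Ioc t b, Q s)
    (hl : ∀ t ∈ Ioc a b, ∃ s₀ < t, ∀ s ∈ Ioo s₀ t, a ≤ s → Q s → Q t) : Q b := by
  set T : Set ℝ := {t | t ∈ Icc a b ∧ Q t} with hT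
  have haT : a ∈ T := ⟨left_mem_Icc.2 hab, ha⟩
  have hbdd : BddAbove T := ⟨b, fun t ht => ht.1.2⟩
  set c := sSup T with hc
  have hac : a ≤ c := le_csSup hbdd haT
  have hcb : c ≤ b := csSup_le ⟨a, haT⟩ fun t ht => ht.1.2
  have hQc : Q c := by
    rcases hac.eq_or_lt with h | h
    · rwa [← h]
    obtain ⟨s₀, hs₀, hs⟩ := hl c ⟨h, hcb⟩
    obtain ⟨s, hsT, hs'⟩ := exists_lt_of_lt_csSup ⟨a, haT⟩ hs₀
    rcases (le_csSup hbdd hsT).eq_or_lt with h' | h'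
    · rw [hc, ← h']; exact hsT.2
    · exact hs s ⟨hs', h'⟩ hsT.1.1 hsT.2
  rcases hcb.eq_or_lt with h | h
  · rwa [← h]
  obtain ⟨s, hs, hQs⟩ := hr c ⟨hac, h⟩ hQc
  exact absurd (le_csSup hbdd ⟨⟨hac.trans hs.1.le, hs.2⟩, hQs⟩) (not_le.2 hs.1)

namespace SpacetimeStructure

variable {g : SpacetimeStructure m M}

variable (g) in
lemma exists_stablyBefore_left (z : M) : ∃ w, g.StablyBefore w z := by
  obtain ⟨D⟩ := g.reverse.nonempty_localPush z
  obtain ⟨x, hx⟩ := D.exists_after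
  exact ⟨x, by simpa [reverse_reverse] using hx.reverse⟩

lemma CausalStep.mem_left {Ω : Set M} {p q : M} (h : g.CausalStep Ω p q) : p ∈ Ω := by
  obtain ⟨γ, a, b, hγ, hΩ, rfl, rfl⟩ := h
  exact hΩ a (left_mem_Icc.2 hγ.1.le)

lemma CausalStep.mem_right {Ω : Set M} {p q : M} (h : g.CausalStep Ω p q) : q ∈ Ω := by
  obtain ⟨γ, a, b, hγ, hΩ, rfl, rfl⟩ := h
  exact hΩ b (right_mem_Icc.2 hγ.1.le)

lemma StablyBefore.of_causalStep_local {z w x y : M} (D : g.LocalPush z)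
    (h : g.StablyBefore w x) (hxy : g.CausalStep D.U x y) : g.StablyBefore w y := by
  have hx := hxy.mem_left
  have hy := hxy.mem_right
  have h1 : ∀ᶠ δ in 𝓝[>] (0 : ℝ), g.StablyBefore w (D.push δ x) :=
    ((D.tendsto_push x hx).eventually h.eventually_right).filter_mono nhdsWithin_le_nhds
  have h2 : ∀ᶠ δ in 𝓝[>] (0 : ℝ), δ ∈ Ioo 0 D.δ₀ := Ioo_mem_nhdsGT D.δ₀_pos
  obtain ⟨δ, hδ, hδ0, hδ1⟩ := (h1.and h2).exists
  have h3 := D.stablyBefore_push 0 δ le_rfl hδ0 hδ1 y hy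
  rw [D.push_zero y hy] at h3
  have h4 := D.timelikeStep_push δ hδ0 hδ1 x y hxy
  rw [StablyBefore, nhds_prod_eq]
  filter_upwards [hδ.eventually_left.prod_mk h3.eventually_right] with p hp
  exact hp.1.chronLT.trans (.trans (.single h4) hp.2.chronLT)

/-- A stable chronological relation is preserved when the end point is moved along a causal
curve. -/
lemma StablyBefore.of_causalStep {w x y : M} (h : g.StablyBefore w x)
    (hxy : g.CausalStep univ x y) : g.StablyBefore w y := by
  obtain ⟨γ, a, b, hγ, -, rfl, rfl⟩ := hxy
  -- short pieces of the curve lie in neighbourhoods to which the local statement applies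
  have hloc : ∀ t ∈ Icc a b, ∃ ε > 0, ∀ s s', s ∈ Icc a b → s' ∈ Icc a b → s < s' →
      t - ε < s → s' < t + ε → g.StablyBefore w (γ s) → g.StablyBefore w (γ s') := by
    intro t ht
    obtain ⟨D⟩ := g.nonempty_localPush (γ t)
    have h1 : ∀ᶠ s in 𝓝[Icc a b] t, γ s ∈ D.U :=
      (hγ.continuousOn t ht) (D.isOpen_U.mem_nhds D.mem_U)
    obtain ⟨ε, hε, h2⟩ := Metric.mem_nhdsWithin_iff.1 h1
    refine ⟨ε, hε, fun s s' hs hs' hss' h3 h4 hw => hw.of_causalStep_local D ?_⟩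
    refine ⟨γ, s, s', hγ.mono hss' hs.1 hs'.2, fun r hr => h2 ⟨?_, ?_⟩, rfl, rfl⟩
    · rw [Metric.mem_ball, Real.dist_eq, abs_lt]
      constructor <;> linarith [hr.1, hr.2]
    · exact ⟨hs.1.trans hr.1, hr.2.trans hs'.2⟩
  refine interval_induction (Q := fun t => g.StablyBefore w (γ t)) hγ.1.le h ?_ ?_
  · intro t ht hQ
    obtain ⟨ε, hε, hs⟩ := hloc t ⟨ht.1, ht.2.le⟩
    have h1 : t < min b (t + ε / 2) := lt_min ht.2 (by linarith)
    refine ⟨min b (t + ε / 2), ⟨h1, min_le_left _ _⟩,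
      hs t _ ⟨ht.1, ht.2.le⟩ ⟨ht.1.trans h1.le, min_le_left _ _⟩ h1 (by linarith) ?_ hQ⟩
    exact (min_le_right _ _).trans_lt (by linarith)
  · intro t ht
    obtain ⟨ε, hε, hs⟩ := hloc t ⟨ht.1.le, ht.2⟩
    exact ⟨t - ε, by linarith, fun s hst has hQ =>
      hs s t ⟨has, hst.2.le.trans ht.2⟩ ⟨ht.1.le, ht.2⟩ hst.2 hst.1 (by linarith) hQ⟩

lemma StablyBefore.of_causalLE {w x y : M} (h : g.StablyBefore w x)
    (hxy : g.CausalLE univ x y) : g.StablyBefore w y := by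
  induction hxy with
  | refl => exact h
  | tail _ h2 ih => exact ih.of_causalStep h2

/-- A causal curve that leaves an open set `O` has a first point on the frontier of `O`. -/
lemma CausalLE.exists_frontier {Ω O : Set M} (hO : IsOpen O) {x q : M} (h : g.CausalLE Ω x q)
    (hx : x ∈ O) (hq : q ∉ O) :
    ∃ y ∈ frontier O, g.CausalLE (Ω ∩ closure O) x y ∧ g.CausalLE Ω y q := by
  induction h using Relation.ReflTransGen.head_induction_on with
  | refl => exact absurd hx hq
  | head hstep hrest ih =>
    obtain ⟨γ, a, b, hγ, hΩ, rfl, rfl⟩ := hstep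
    by_cases hin : ∀ t ∈ Icc a b, γ t ∈ O
    · obtain ⟨y, hy, h1, h2⟩ := ih (hin b (right_mem_Icc.2 hγ.1.le))
      exact ⟨y, hy, .head ⟨γ, a, b, hγ, fun t ht => ⟨hΩ t ht, subset_closure (hin t ht)⟩, rfl, rfl⟩
        h1, h2⟩
    push Not at hin
    have hclosed : IsClosed (Icc a b ∩ γ ⁻¹' Oᶜ) :=
      hγ.continuousOn.preimage_isClosed_of_isClosed isClosed_Icc hO.isClosed_compl
    have hne : (Icc a b ∩ γ ⁻¹' Oᶜ).Nonempty := hin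
    have hbdd : BddBelow (Icc a b ∩ γ ⁻¹' Oᶜ) := ⟨a, fun t ht => ht.1.1⟩
    obtain ⟨⟨hat, htb⟩, htO⟩ := hclosed.csInf_mem hne hbdd
    set t₀ := sInf (Icc a b ∩ γ ⁻¹' Oᶜ) with ht₀
    have hbefore : ∀ t ∈ Ico a t₀, γ t ∈ O := by
      intro t ht
      by_contra hcon
      exact absurd (csInf_le hbdd ⟨⟨ht.1, ht.2.le.trans htb⟩, hcon⟩) (not_le.2 ht.2)
    have ha : a < t₀ := lt_of_le_of_ne hat fun h => htO (by rw [← h]; exact hx)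
    have hcl : γ t₀ ∈ closure O := by
      have h1 : ContinuousWithinAt γ (Ico a t₀) t₀ :=
        (hγ.continuousOn t₀ ⟨hat, htb⟩).mono fun t ht => ⟨ht.1, ht.2.le.trans htb⟩
      exact h1.mem_closure (by rw [closure_Ico ha.ne]; exact right_mem_Icc.2 ha.le) hbefore
    refine ⟨γ t₀, ⟨hcl, by rwa [hO.interior_eq]⟩, .single ⟨γ, a, t₀, hγ.mono ha le_rfl htb,
      fun t ht => ⟨hΩ t ⟨ht.1, ht.2.trans htb⟩, ?_⟩, rfl, rfl⟩, ?_⟩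
    · rcases ht.2.eq_or_lt with h | h
      · rw [h]; exact hcl
      · exact subset_closure (hbefore t ⟨ht.1, h⟩)
    · rcases htb.eq_or_lt with h | h
      · rw [h]; exact hrest
      · exact .head ⟨γ, t₀, b, hγ.mono h hat le_rfl, fun t ht => hΩ t ⟨hat.trans ht.1, ht.2⟩,
          rfl, rfl⟩ hrest

/-- A limit of causal relations inside a small neighbourhood becomes a chronological relation after
its end points are moved slightly into the past. -/
lemma StablyBefore.exists_of_tendsto {z : M} (D : g.LocalPush z) {ι : Type*} {l : Filter ι} [l.NeBot]
    {f f' : ι → M} {x y w : M} (hx : x ∈ D.U) (hy : y ∈ D.U) (hf : Tendsto f l (𝓝 x))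
    (hf' : Tendsto f' l (𝓝 y)) (hff' : ∀ᶠ i in l, g.CausalLE D.U (f i) (f' i))
    (hw : g.StablyBefore w x) {W : Set M} (hW : W ∈ 𝓝 y) :
    ∃ w' ∈ W, g.StablyBefore w' y ∧ g.ChronLT w w' := by
  have h1 : ∀ᶠ δ in 𝓝[>] (0 : ℝ), g.StablyBefore w (D.push δ x) :=
    ((D.tendsto_push x hx).eventually hw.eventually_right).filter_mono nhdsWithin_le_nhds
  have h2 : ∀ᶠ δ in 𝓝[>] (0 : ℝ), δ ∈ Ioo 0 D.δ₀ := Ioo_mem_nhdsGT D.δ₀_pos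
  have h3 : ∀ᶠ δ in 𝓝[>] (0 : ℝ), D.push (δ / 2) y ∈ W := by
    have h4 : Tendsto (fun δ : ℝ => δ / 2) (𝓝 0) (𝓝 0) := by
      have : Continuous fun δ : ℝ => δ / 2 := by fun_prop
      simpa using this.tendsto 0
    exact (((D.tendsto_push y hy).comp h4).eventually hW).filter_mono nhdsWithin_le_nhds
  obtain ⟨δ, hδ, ⟨hδ0, hδ1⟩, hδW⟩ := (h1.and (h2.and h3)).exists
  have h5 : ∀ᶠ i in l, g.StablyBefore w (D.push δ (f i)) :=
    ((D.continuousAt_push δ hδ0.le hδ1 x hx).tendsto.comp hf).eventually hδ.eventually_right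
  have h6 : ∀ᶠ i in l, g.StablyBefore (D.push δ (f' i)) (D.push (δ / 2) y) :=
    ((D.continuousAt_push δ hδ0.le hδ1 y hy).tendsto.comp hf').eventually
      (D.stablyBefore_push (δ / 2) δ (by linarith) (by linarith) hδ1 y hy).eventually_left
  obtain ⟨i, hi1, hi2, hi3⟩ := (hff'.and (h5.and h6)).exists
  have h7 : Relation.ReflTransGen g.TimelikeStep (D.push δ (f i)) (D.push δ (f' i)) :=
    Relation.ReflTransGen.lift (D.push δ) (fun p q h => D.timelikeStep_push δ hδ0 hδ1 p q h)
      _ _ hi1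
  have h8 := D.stablyBefore_push 0 (δ / 2) le_rfl (by linarith) (by linarith) y hy
  rw [D.push_zero y hy] at h8
  exact ⟨_, hδW, h8, (Relation.TransGen.trans_left hi2.chronLT h7).trans hi3.chronLT⟩

/-- The causal future of a compact set `K` lies in an open set which lies in the causal future of
another compact set: cover `K` by the stable futures of finitely many points. -/
lemma exists_open_causalFuture {K : Set M} (hK : IsCompact K) :
    ∃ (K' U : Set M), IsCompact K' ∧ IsOpen U ∧ g.causalFuture univ K ⊆ U ∧
      U ⊆ g.causalFuture univ K' := by
  choose w hw using g.exists_stablyBefore_left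
  obtain ⟨t, -, ht⟩ := hK.elim_nhds_subcover (fun p => {x | g.StablyBefore (w p) x})
    (fun p _ => (hw p).eventually_right)
  refine ⟨w '' t, {y | ∃ p ∈ w '' (t : Set M), g.StablyBefore p y},
    (t.finite_toSet.image w).isCompact, ?_, ?_, ?_⟩
  · rw [isOpen_iff_eventually]
    rintro y ⟨p, hp, h⟩
    exact h.eventually_right.mono fun y' h' => ⟨p, hp, h'⟩
  · rintro q ⟨p, ⟨hpK, -⟩, hpq⟩
    obtain ⟨p', hp', h⟩ := mem_iUnion₂.1 (ht hpK)
    exact ⟨w p', mem_image_of_mem w hp', StablyBefore.of_causalLE h hpq⟩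
  · rintro y ⟨p, hp, h⟩
    exact ⟨p, ⟨hp, mem_univ _⟩, h.chronLT.causalLE⟩

end SpacetimeStructure

end LocalCausality

/-! ### Inextensible timelike curves -/

section Curves

variable {m : ℕ} {M : Type*} [TopologicalSpace M] [ChartedSpace (E m) M]
  [IsManifold (𝓡 m) ∞ M]

namespace SpacetimeStructure

variable {g : SpacetimeStructure m M}

variable (g) in
/-- `γ` restricted to `[a, b]` is a future-directed timelike piecewise `C¹` curve. -/
def IsPiecewiseTimelike (γ : ℝ → M) (a b : ℝ) : Prop :=
  (∀ t ∈ Ico a b, ∃ ε > 0, t + ε ≤ b ∧ g.IsTimelikeArc γ t (t + ε)) ∧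
  (∀ t ∈ Ioc a b, ∃ ε > 0, a ≤ t - ε ∧ g.IsTimelikeArc γ (t - ε) t)

lemma IsTimelikeArc.isPiecewiseTimelike {γ : ℝ → M} {a b : ℝ} (h : g.IsTimelikeArc γ a b) :
    g.IsPiecewiseTimelike γ a b := by
  refine ⟨fun t ht => ⟨b - t, by linarith [ht.2], by linarith, ?_⟩,
    fun t ht => ⟨t - a, by linarith [ht.1], by linarith, ?_⟩⟩
  · rw [add_sub_cancel]
    exact h.mono ht.2 ht.1 le_rfl
  · rw [sub_sub_cancel]
    exact h.mono ht.1 le_rfl ht.2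

lemma IsPiecewiseTimelike.congr {γ γ' : ℝ → M} {a b : ℝ} (h : g.IsPiecewiseTimelike γ a b)
    (hγ : ∀ t ∈ Icc a b, γ' t = γ t) : g.IsPiecewiseTimelike γ' a b := by
  refine ⟨fun t ht => ?_, fun t ht => ?_⟩
  · obtain ⟨ε, hε, h1, h2⟩ := h.1 t ht
    exact ⟨ε, hε, h1, h2.congr fun s hs => hγ s ⟨ht.1.trans hs.1, hs.2.trans h1⟩⟩
  · obtain ⟨ε, hε, h1, h2⟩ := h.2 t ht
    exact ⟨ε, hε, h1, h2.congr fun s hs => hγ s ⟨h1.trans hs.1, hs.2.trans ht.2⟩⟩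

lemma IsPiecewiseTimelike.comp_affine {γ : ℝ → M} {a b a' b' α β : ℝ}
    (h : g.IsPiecewiseTimelike γ a b) (hα : 0 < α) (ha : α * a' + β = a) (hb : α * b' + β = b) :
    g.IsPiecewiseTimelike (fun s => γ (α * s + β)) a' b' := by
  subst ha hb
  have hdiv : ∀ ε, α * (ε / α) = ε := fun ε => by field_simp
  refine ⟨fun t ht => ?_, fun t ht => ?_⟩
  · obtain ⟨ε, hε, h1, h2⟩ := h.1 (α * t + β) ⟨by nlinarith [ht.1], by nlinarith [ht.2]⟩
    have hpos : 0 < ε / α := div_pos hε hα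
    refine ⟨ε / α, hpos, ?_, h2.comp_affine hα (by linarith) fun s hs => ⟨?_, ?_⟩⟩
    · have := hdiv ε
      refine le_of_mul_le_mul_left ?_ hα
      linarith
    · nlinarith [hs.1]
    · have h3 := mul_le_mul_of_nonneg_left hs.2 hα.le
      rw [mul_add, hdiv] at h3
      linarith
  · obtain ⟨ε, hε, h1, h2⟩ := h.2 (α * t + β) ⟨by nlinarith [ht.1], by nlinarith [ht.2]⟩
    have hpos : 0 < ε / α := div_pos hε hα
    refine ⟨ε / α, hpos, ?_, h2.comp_affine hα (by linarith) fun s hs => ⟨?_, ?_⟩⟩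
    · have := hdiv ε
      refine le_of_mul_le_mul_left ?_ hα
      rw [mul_sub, hdiv]
      linarith
    · have h3 := mul_le_mul_of_nonneg_left hs.1 hα.le
      rw [mul_sub, hdiv] at h3
      linarith
    · nlinarith [hs.2]

lemma IsPiecewiseTimelike.trans {γ : ℝ → M} {a b c : ℝ} (hab : a ≤ b) (hbc : b ≤ c)
    (h : g.IsPiecewiseTimelike γ a b) (h' : g.IsPiecewiseTimelike γ b c) :
    g.IsPiecewiseTimelike γ a c := by
  refine ⟨fun t ht => ?_, fun t ht => ?_⟩
  · rcases lt_or_ge t b with htb | htb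
    · obtain ⟨ε, hε, h1, h2⟩ := h.1 t ⟨ht.1, htb⟩
      exact ⟨ε, hε, h1.trans hbc, h2⟩
    · exact h'.1 t ⟨htb, ht.2⟩
  · rcases lt_or_ge b t with htb | htb
    · obtain ⟨ε, hε, h1, h2⟩ := h'.2 t ⟨htb, ht.2⟩
      exact ⟨ε, hε, hab.trans h1, h2⟩
    · exact h.2 t ⟨ht.1, htb⟩

/-- No finiteness of the set of break points is assumed in `IsPiecewiseTimelike`; it follows by
induction along the interval. -/
lemma IsPiecewiseTimelike.chronLT {γ : ℝ → M} {a b : ℝ} (hab : a < b)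
    (h : g.IsPiecewiseTimelike γ a b) : g.ChronLT (γ a) (γ b) := by
  have key : b = a ∨ g.ChronLT (γ a) (γ b) := by
    have hstep : ∀ s t, g.IsTimelikeArc γ s t → (s = a ∨ g.ChronLT (γ a) (γ s)) →
        g.ChronLT (γ a) (γ t) := by
      rintro s t hst (rfl | hs)
      · exact .single ⟨γ, s, t, hst, rfl, rfl⟩
      · exact .tail hs ⟨γ, s, t, hst, rfl, rfl⟩
    refine interval_induction (Q := fun t => t = a ∨ g.ChronLT (γ a) (γ t)) hab.le (Or.inl rfl) ?_ ?_
    · intro t ht hQ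
      obtain ⟨ε, hε, h1, h2⟩ := h.1 t ht
      exact ⟨t + ε, ⟨by linarith, h1⟩, Or.inr (hstep t _ h2 hQ)⟩
    · intro t ht
      obtain ⟨ε, hε, h1, h2⟩ := h.2 t ht
      exact ⟨t - ε, by linarith, fun s hs _ hQ =>
        Or.inr (hstep s t (h2.mono hs.2 hs.1.le le_rfl) hQ)⟩
  exact key.resolve_left hab.ne'

lemma ChronLT.exists_curve {p q : M} (h : g.ChronLT p q) :
    ∃ γ : ℝ → M, g.IsPiecewiseTimelike γ 0 1 ∧ γ 0 = p ∧ γ 1 = q := by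
  induction h with
  | single h =>
    obtain ⟨γ, a, b, hγ, rfl, rfl⟩ := h
    refine ⟨_, hγ.isPiecewiseTimelike.comp_affine (α := b - a) (β := a) (a' := 0) (b' := 1)
      (sub_pos.2 hγ.1) (by ring) (by ring), ?_, ?_⟩ <;> simp
  | tail _ h ih =>
    obtain ⟨γ₁, h₁, rfl, h1b⟩ := ih
    obtain ⟨γ, a, b, hγ, rfl, rfl⟩ := h
    have k1 := h₁.comp_affine (α := 2) (β := 0) (a' := 0) (b' := 1 / 2) two_pos (by norm_num)
      (by norm_num)
    have k2 := hγ.isPiecewiseTimelike.comp_affine (α := 2 * (b - a)) (β := a - (b - a))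
      (a' := 1 / 2) (b' := 1) (by linarith [hγ.1]) (by ring) (by ring)
    refine ⟨fun t => if t ≤ 1 / 2 then γ₁ (2 * t + 0) else γ (2 * (b - a) * t + (a - (b - a))),
      .trans (b := 1 / 2) (by norm_num) (by norm_num) (k1.congr fun t ht => if_pos ht.2)
        (k2.congr fun t ht => ?_), ?_, ?_⟩
    · split_ifs with hle
      · have : t = 1 / 2 := le_antisymm hle ht.1
        subst this
        have e1 : (2 : ℝ) * (1 / 2) + 0 = 1 := by norm_num
        have e2 : 2 * (b - a) * (1 / 2) + (a - (b - a)) = a := by ring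
        rw [e1, e2, h1b]
      · rfl
    · norm_num
    · norm_num
      congr 1
      ring

/-- Joining infinitely many timelike curves: a bi-infinite chronological sequence lies on a
timelike curve, which is inextensible if the sequence converges at neither end. -/
lemma exists_isInextensibleTimelike_of_seq {w : ℤ → M} (hw : ∀ k, g.ChronLT (w k) (w (k + 1)))
    (htop : ¬ ∃ p, Tendsto w atTop (𝓝 p)) (hbot : ¬ ∃ p, Tendsto w atBot (𝓝 p)) :
    ∃ γ : ℝ → M, g.IsInextensibleTimelike univ γ ∧ (∀ k : ℤ, γ k = w k) ∧
      ∀ s t, s < t → g.ChronLT (γ s) (γ t) := by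
  choose c hc hc0 hc1 using fun k => (hw k).exists_curve
  set γ : ℝ → M := fun t => c ⌊t⌋ (t - ⌊t⌋) with hγ
  have hγk : ∀ k : ℤ, γ k = w k := fun k => by simp [hγ, hc0]
  have hpiece : ∀ k : ℤ, g.IsPiecewiseTimelike γ k (k + 1) := by
    intro k
    refine ((hc k).comp_affine (α := 1) (β := -k) (a' := k) (b' := k + 1) one_pos (by ring)
      (by ring)).congr fun t ht => ?_
    rcases ht.2.eq_or_lt with h | h
    · have h1 := hγk (k + 1)
      push_cast at h1
      rw [h, h1]
      have h2 : 1 * ((k : ℝ) + 1) + -k = 1 := by ring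
      rw [h2, hc1]
    · have h1 : ⌊t⌋ = k := Int.floor_eq_iff.2 ⟨ht.1, h⟩
      rw [hγ]
      simp only [h1, one_mul, sub_eq_add_neg]
  have hright : ∀ t, ∃ ε > 0, g.IsTimelikeArc γ t (t + ε) := fun t => by
    obtain ⟨ε, hε, -, h⟩ := (hpiece ⌊t⌋).1 t ⟨Int.floor_le t, Int.lt_floor_add_one t⟩
    exact ⟨ε, hε, h⟩
  have hleft : ∀ t, ∃ ε > 0, g.IsTimelikeArc γ (t - ε) t := fun t => by
    obtain ⟨ε, hε, -, h⟩ := (hpiece (⌈t⌉ - 1)).2 t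
      ⟨by push_cast; linarith [Int.ceil_lt_add_one t], by push_cast; linarith [Int.le_ceil t]⟩
    exact ⟨ε, hε, h⟩
  refine ⟨γ, ⟨fun _ => mem_univ _, fun t => ?_, ?_, ?_⟩, hγk, fun s t hst => ?_⟩
  · obtain ⟨ε₁, h₁, k₁⟩ := hleft t
    obtain ⟨ε₂, h₂, k₂⟩ := hright t
    have h3 : 0 < min ε₁ ε₂ := lt_min h₁ h₂
    exact ⟨min ε₁ ε₂, h3, k₁.mono (by linarith) (by linarith [min_le_left ε₁ ε₂]) le_rfl,
      k₂.mono (by linarith) le_rfl (by linarith [min_le_right ε₁ ε₂])⟩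
  · rintro ⟨p, -, hp⟩
    refine htop ⟨p, ?_⟩
    have h1 := hp.comp (tendsto_intCast_atTop_atTop (R := ℝ))
    exact h1.congr hγk
  · rintro ⟨p, -, hp⟩
    refine hbot ⟨p, ?_⟩
    have h1 := hp.comp (tendsto_intCast_atBot_iff.2 tendsto_id : Tendsto (fun k : ℤ => (k : ℝ)) _ _)
    exact h1.congr hγk
  · refine IsPiecewiseTimelike.chronLT hst ⟨fun r hr => ?_, fun r hr => ?_⟩
    · obtain ⟨ε, hε, h⟩ := hright r
      have h1 : 0 < min ε (t - r) := lt_min hε (by linarith [hr.2])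
      exact ⟨min ε (t - r), h1, by linarith [min_le_right ε (t - r)],
        h.mono (by linarith) le_rfl (by linarith [min_le_left ε (t - r)])⟩
    · obtain ⟨ε, hε, h⟩ := hleft r
      have h1 : 0 < min ε (r - s) := lt_min hε (by linarith [hr.1])
      exact ⟨min ε (r - s), h1, by linarith [min_le_right ε (r - s)],
        h.mono (by linarith) (by linarith [min_le_left ε (r - s)]) le_rfl⟩

/-- A sequence which, from its position in the first of countably many sets `V n` that contains it,
always jumps out of a larger open set `O n`, does not converge. -/
lemma not_tendsto_of_leaves {X : Type*} [TopologicalSpace X] {V O : ℕ → Set X} {x : ℕ → X}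
    {j : ℕ → ℕ} (hV : ∀ n, IsOpen (V n)) (hO : ∀ n, IsOpen (O n)) (hVO : ∀ n, closure (V n) ⊆ O n)
    (hcov : ∀ p, ∃ n, p ∈ V n) (hj : ∀ k, x k ∈ V (j k)) (hmin : ∀ k n, x k ∈ V n → j k ≤ n)
    (hleave : ∀ k, x (k + 1) ∉ O (j k)) (p : X) : ¬ Tendsto x atTop (𝓝 p) := by
  intro hp
  obtain ⟨n, hn⟩ := hcov p
  have h1 : ∀ᶠ k in atTop, j k ≤ n :=
    (hp.eventually ((hV n).mem_nhds hn)).mono fun k hk => hmin k n hk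
  obtain ⟨i, hi⟩ : ∃ i, ∃ᶠ k in atTop, j k = i := by
    by_contra hcon
    push Not at hcon
    have h2 : ∀ᶠ k in atTop, ∀ i ∈ Iic n, j k ≠ i :=
      (eventually_all_finite (finite_Iic n)).2 fun i _ => hcon i
    obtain ⟨k, hk1, hk2⟩ := (h1.and h2).exists
    exact hk2 _ hk1 rfl
  have h3 : p ∈ closure (V i) :=
    mem_closure_of_frequently_of_tendsto (hi.mono fun k hk => hk ▸ hj k) hp
  have h4 : p ∈ (O i)ᶜ := by
    rw [← (hO i).isClosed_compl.closure_eq]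
    exact mem_closure_of_frequently_of_tendsto (hi.mono fun k hk => hk ▸ hleave k)
      (hp.comp (tendsto_add_atTop_nat 1))
  exact h4 (hVO i h3)

variable (g) in
/-- Any point of `A` can be left within `A`, along chronological relations, through the frontier of
any small open set that contains it. -/
def Escapes (A : Set M) : Prop :=
  ∀ x ∈ A, ∀ (z : M) (D : g.LocalPush z) (O : Set M), IsOpen O → x ∈ O → closure O ⊆ D.U →
    IsCompact (closure O) → ∃ y ∈ A ∩ frontier O, ∀ w, g.StablyBefore w x → ∀ W ∈ 𝓝 y,
      ∃ w' ∈ W, g.StablyBefore w' y ∧ g.ChronLT w w'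

lemma escapes_univ : g.Escapes univ := by
  intro x _ z D O hO hx hOD hOc
  obtain ⟨q, hqU, hqO, hxq⟩ := D.exists_escape x (hOD (subset_closure hx)) _ hOD hOc
  obtain ⟨y, hy, hxy, -⟩ := CausalLE.exists_frontier hO (.single hxq) hx
    (fun h => hqO (subset_closure h))
  refine ⟨y, ⟨mem_univ _, hy⟩, fun w hw W hW => ?_⟩
  exact StablyBefore.exists_of_tendsto (l := (pure () : Filter Unit)) (f := fun _ => x)
    (f' := fun _ => y) D (hOD (subset_closure hx)) (hOD (frontier_subset_closure hy))
    tendsto_const_nhds tendsto_const_nhds (Eventually.of_forall fun _ => hxy.mono inter_subset_left)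
    hw hW

/-- The points from which, in the limit, causal curves lead to the points of an ultrafilter that
leaves every compact set. -/
lemma escapes_of_ultrafilter {l : Ultrafilter M} (hl : (l : Filter M) ≤ cocompact M) :
    g.Escapes {x | ∃ f : M → M, Tendsto f l (𝓝 x) ∧ ∀ᶠ q in l, g.CausalLE univ (f q) q} := by
  rintro x ⟨f, hf, hfq⟩ z D O hO hx hOD hOc
  have h1 : ∀ᶠ q in l, q ∉ O :=
    Filter.Eventually.mono (hl hOc.compl_mem_cocompact) fun q hq h => hq (subset_closure h)
  have h2 : ∀ᶠ q in l, f q ∈ O := hf (hO.mem_nhds hx)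
  have h3 : ∀ᶠ q in l, ∃ y ∈ frontier O, g.CausalLE (univ ∩ closure O) (f q) y ∧
      g.CausalLE univ y q := by
    filter_upwards [h1, h2, hfq] with q hq1 hq2 hq3
    exact hq3.exists_frontier hO hq2 hq1
  obtain ⟨f', hf'⟩ : ∃ f' : M → M, ∀ᶠ q in l, f' q ∈ frontier O ∧
      g.CausalLE (univ ∩ closure O) (f q) (f' q) ∧ g.CausalLE univ (f' q) q := by
    classical
    refine ⟨fun q => if h : ∃ y ∈ frontier O, g.CausalLE (univ ∩ closure O) (f q) y ∧
      g.CausalLE univ y q then h.choose else q, h3.mono fun q hq => ?_⟩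
    simp only [dif_pos hq]
    exact hq.choose_spec
  have hfc : IsCompact (frontier O) := hOc.of_isClosed_subset isClosed_frontier
    frontier_subset_closure
  obtain ⟨y, hy, hly⟩ := hfc.ultrafilter_le_nhds' (l.map f') (hf'.mono fun q hq => hq.1)
  refine ⟨y, ⟨⟨f', hly, hf'.mono fun q hq => hq.2.2⟩, hy⟩, fun w hw W hW => ?_⟩
  exact StablyBefore.exists_of_tendsto D (hOD (subset_closure hx)) (hOD (frontier_subset_closure hy))
    hf hly (hf'.mono fun q hq => hq.2.1.mono fun p hp => hOD hp.2) hw hW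

variable [T2Space M] [SecondCountableTopology M]

/-- A chronological sequence without limit that stays stably before points of `A`. The step from a
point of `A` goes to the frontier of the first of countably many open sets whose smaller partner
contains the point, and the members of the sequence come closer and closer to the points of `A`. -/
lemma Escapes.exists_seq {A : Set M} (hA : g.Escapes A) {w₀ x₀ : M} (hx₀ : x₀ ∈ A)
    (h₀ : g.StablyBefore w₀ x₀) :
    ∃ w : ℕ → M, w 0 = w₀ ∧ (∀ k, g.ChronLT (w k) (w (k + 1))) ∧
      (∀ k, ∃ y ∈ A, g.StablyBefore (w k) y) ∧ ¬ ∃ p, Tendsto w atTop (𝓝 p) := by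
  have : LocallyCompactSpace M := Manifold.locallyCompact_of_finiteDimensional (𝓡 m)
  have : TopologicalSpace.MetrizableSpace M := Manifold.metrizableSpace (𝓡 m) M
  let : MetricSpace M := TopologicalSpace.metrizableSpaceMetric M
  have hnest : ∀ z : M, ∃ (D : g.LocalPush z) (V O : Set M), IsOpen V ∧ IsOpen O ∧ z ∈ V ∧
      closure V ⊆ O ∧ closure O ⊆ D.U ∧ IsCompact (closure O) := by
    intro z
    obtain ⟨D⟩ := g.nonempty_localPush z
    obtain ⟨O, hO, hzO, hOD, hOc⟩ := exists_open_between_and_isCompact_closure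
      (isCompact_singleton (x := z)) D.isOpen_U (singleton_subset_iff.2 D.mem_U)
    obtain ⟨V, hV, hzV, hVO, -⟩ := exists_open_between_and_isCompact_closure
      (isCompact_singleton (x := z)) hO hzO
    exact ⟨D, V, O, hV, hO, singleton_subset_iff.1 hzV, hVO, hOD, hOc⟩
  choose D V O hV hO hzV hVO hOD hOc using hnest
  obtain ⟨s, hs, hcov⟩ := TopologicalSpace.countable_cover_nhds fun z => (hV z).mem_nhds (hzV z)
  have hsne : s.Nonempty := by
    by_contra hcon
    rw [not_nonempty_iff_eq_empty.1 hcon] at hcov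
    simp only [biUnion_empty] at hcov
    exact absurd (mem_univ x₀) (hcov ▸ notMem_empty x₀)
  obtain ⟨c, rfl⟩ := hs.exists_eq_range hsne
  have hcov' : ∀ p, ∃ n, p ∈ V (c n) := fun p => by
    have := hcov ▸ mem_univ p
    simpa using this
  classical
  set J : M → ℕ := fun p => Nat.find (hcov' p) with hJ
  have hJV : ∀ p, p ∈ V (c (J p)) := fun p => Nat.find_spec (hcov' p)
  -- the states of the construction: a point of `A` and a point stably before it
  let S := {p : M × M // g.StablyBefore p.1 p.2 ∧ p.2 ∈ A}
  have hstep : ∀ (k : ℕ) (p : S), ∃ p' : S, g.ChronLT p.1.1 p'.1.1 ∧ p'.1.2 ∉ O (c (J p.1.2)) ∧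
      dist p'.1.1 p'.1.2 < 1 / ((k : ℝ) + 1) := by
    rintro k ⟨⟨w, x⟩, hwx, hx⟩
    have hxO : x ∈ O (c (J x)) := hVO _ (subset_closure (hJV x))
    obtain ⟨y, ⟨hyA, hyO⟩, hy⟩ := hA x hx _ (D (c (J x))) _ (hO _) hxO (hOD _) (hOc _)
    obtain ⟨w', hw', h1, h2⟩ := hy w hwx (Metric.ball y (1 / ((k : ℝ) + 1)))
      (Metric.ball_mem_nhds y (by positivity))
    refine ⟨⟨(w', y), h1, hyA⟩, h2, ?_, hw'⟩
    rw [(hO _).frontier_eq] at hyO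
    exact hyO.2
  choose next hnext using hstep
  let seq : ℕ → S := fun k => Nat.rec ⟨(w₀, x₀), h₀, hx₀⟩ (fun k p => next k p) k
  have hseq : ∀ k, seq (k + 1) = next k (seq k) := fun k => rfl
  refine ⟨fun k => (seq k).1.1, rfl, fun k => ?_, fun k => ⟨_, (seq k).2.2, (seq k).2.1⟩, ?_⟩
  · exact (hnext k (seq k)).1
  · rintro ⟨p, hp⟩
    have hdist : Tendsto (fun k => dist (seq (k + 1)).1.1 (seq (k + 1)).1.2) atTop (𝓝 0) := by
      refine squeeze_zero (fun _ => dist_nonneg) (fun k => ?_) tendsto_one_div_add_atTop_nhds_zero_nat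
      rw [hseq]
      exact (hnext k (seq k)).2.2.le
    have hx1 : Tendsto (fun k => (seq (k + 1)).1.2) atTop (𝓝 p) :=
      (tendsto_iff_of_dist hdist).1 (hp.comp (tendsto_add_atTop_nat 1))
    have hx2 : Tendsto (fun k => (seq k).1.2) atTop (𝓝 p) := (tendsto_add_atTop_iff_nat 1).1 hx1
    refine not_tendsto_of_leaves (V := fun n => V (c n)) (O := fun n => O (c n))
      (j := fun k => J (seq k).1.2) (fun n => hV _) (fun n => hO _) (fun n => hVO _) hcov'
      (fun k => hJV _) (fun k n hn => Nat.find_min' _ hn) (fun k => ?_) p hx2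
    rw [hseq]
    exact (hnext k (seq k)).2.1

variable (g) in
lemma exists_future_seq (p : M) : ∃ w : ℕ → M, w 0 = p ∧ (∀ k, g.ChronLT (w k) (w (k + 1))) ∧
    ¬ ∃ q, Tendsto w atTop (𝓝 q) := by
  obtain ⟨D⟩ := g.nonempty_localPush p
  obtain ⟨x, hx⟩ := D.exists_after
  obtain ⟨w, h0, h1, -, h2⟩ := escapes_univ.exists_seq (mem_univ x) hx
  exact ⟨w, h0, h1, h2⟩

/-- A chronological sequence without limit lies on an inextensible timelike curve: it is continued
into the past by a sequence without limit for the reversed time orientation. -/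
lemma exists_isInextensibleTimelike_extending {u : ℕ → M} (hu : ∀ k, g.ChronLT (u k) (u (k + 1)))
    (hlim : ¬ ∃ q, Tendsto u atTop (𝓝 q)) :
    ∃ γ : ℝ → M, g.IsInextensibleTimelike univ γ ∧ (∀ k : ℕ, γ k = u k) ∧
      ∀ s t, s < t → g.ChronLT (γ s) (γ t) := by
  obtain ⟨v, hv0, hv, hvlim⟩ := g.reverse.exists_future_seq (u 0)
  set w : ℤ → M := fun k => if 0 ≤ k then u k.toNat else v (-k).toNat with hw
  have hwn : ∀ n : ℕ, w n = u n := fun n => by simp [hw]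
  have hwneg : ∀ n : ℕ, w (-n) = v n := fun n => by
    rcases Nat.eq_zero_or_pos n with rfl | hn
    · simp [hw, hv0]
    · simp only [hw]
      rw [if_neg (by omega)]
      simp
  have hchron : ∀ k, g.ChronLT (w k) (w (k + 1)) := by
    intro k
    rcases le_or_gt 0 k with hk | hk
    · obtain ⟨n, rfl⟩ := Int.eq_ofNat_of_zero_le hk
      have := hu n
      rw [← hwn, ← hwn] at this
      exact_mod_cast this
    · obtain ⟨n, hn⟩ := Int.eq_ofNat_of_zero_le (show 0 ≤ -k - 1 by omega)
      have := (g.chronLT_reverse).1 (hv n)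
      rw [← hwneg, ← hwneg] at this
      have e1 : k = -((n + 1 : ℕ) : ℤ) := by push_cast; omega
      have e2 : k + 1 = -(n : ℤ) := by omega
      rw [e2, e1]
      exact this
  have htop : ¬ ∃ p, Tendsto w atTop (𝓝 p) := by
    rintro ⟨p, hp⟩
    exact hlim ⟨p, (hp.comp tendsto_natCast_atTop_atTop).congr hwn⟩
  have hbot : ¬ ∃ p, Tendsto w atBot (𝓝 p) := by
    rintro ⟨p, hp⟩
    exact hvlim ⟨p, (hp.comp (tendsto_neg_atTop_atBot.comp tendsto_natCast_atTop_atTop)).congr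
      hwneg⟩
  obtain ⟨γ, h1, h2, h3⟩ := exists_isInextensibleTimelike_of_seq hchron htop hbot
  exact ⟨γ, h1, fun k => by have := h2 k; rw [hwn] at this; exact_mod_cast this, h3⟩

end SpacetimeStructure

end Curves

/-! ### Cauchy hypersurfaces and compactness of causal diamonds -/

section Cauchy

variable {m : ℕ} {M : Type*} [TopologicalSpace M] [ChartedSpace (E m) M]
  [IsManifold (𝓡 m) ∞ M] [T2Space M] [SecondCountableTopology M]

namespace SpacetimeStructure

variable {g : SpacetimeStructure m M} {S : Set M}

/-- Every point lies on a Cauchy hypersurface, in its past or in its future: follow an inextensible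
timelike curve through the point. -/
lemma IsCauchyHypersurface.trichotomy (hS : g.IsCauchyHypersurface univ S) (q : M) :
    q ∈ S ∨ (∃ s ∈ S, g.ChronLT q s) ∨ ∃ s ∈ S, g.ChronLT s q := by
  obtain ⟨u, hu0, hu, hlim⟩ := g.exists_future_seq q
  obtain ⟨γ, hγ, hγu, hlt⟩ := exists_isInextensibleTimelike_extending hu hlim
  have h0 : γ 0 = q := by simpa [hu0] using hγu 0
  obtain ⟨t, ht, -⟩ := hS.2 γ hγ
  rcases lt_trichotomy t 0 with h | h | h
  · exact Or.inr (Or.inr ⟨γ t, ht, h0 ▸ hlt t 0 h⟩)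
  · exact Or.inl (by rw [← h0, ← h]; exact ht)
  · exact Or.inr (Or.inl ⟨γ t, ht, h0 ▸ hlt 0 t h⟩)

/-- A timelike curve between two points of a Cauchy hypersurface would extend to an inextensible one
that meets the hypersurface twice. -/
lemma IsCauchyHypersurface.achronal (hS : g.IsCauchyHypersurface univ S) {s s' : M} (hs : s ∈ S)
    (hs' : s' ∈ S) : ¬ g.ChronLT s s' := by
  intro h
  obtain ⟨u, hu0, hu, hlim⟩ := g.exists_future_seq s'
  let v : ℕ → M := fun k => Nat.casesOn k s u
  have hv : ∀ k, g.ChronLT (v k) (v (k + 1)) := by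
    rintro (_ | k)
    · show g.ChronLT s (u 0)
      rwa [hu0]
    · exact hu k
  have hvlim : ¬ ∃ q, Tendsto v atTop (𝓝 q) := fun ⟨q, hq⟩ =>
    hlim ⟨q, hq.comp (tendsto_add_atTop_nat 1)⟩
  obtain ⟨γ, hγ, hγv, -⟩ := exists_isInextensibleTimelike_extending hv hvlim
  have h0 : γ 0 ∈ S := by
    have := hγv 0
    rw [Nat.cast_zero] at this
    rw [this]; exact hs
  have h1 : γ 1 ∈ S := by
    have := hγv 1
    rw [Nat.cast_one] at this
    rw [this]; show u 0 ∈ S; rwa [hu0]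
  exact zero_ne_one ((hS.2 γ hγ).unique h0 h1)

/-- The part of the causal future of a compact set that lies on or before a Cauchy hypersurface is
relatively compact. Otherwise there is an ultrafilter on it that leaves every compact set; causal
curves to its points accumulate to an inextensible timelike curve all of whose points are before
points of the ultrafilter, and hence before the hypersurface, which that curve has to meet. -/
lemma IsCauchyHypersurface.exists_compact_causalFuture (hS : g.IsCauchyHypersurface univ S)
    {K : Set M} (hK : IsCompact K) :
    ∃ L, IsCompact L ∧ g.causalFuture univ K ∩ {q | q ∈ S ∨ ∃ s ∈ S, g.ChronLT q s} ⊆ L := by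
  by_contra hcon
  push Not at hcon
  set Dom := g.causalFuture univ K ∩ {q | q ∈ S ∨ ∃ s ∈ S, g.ChronLT q s} with hDom
  have hne : (cocompact M ⊓ 𝓟 Dom).NeBot := by
    rw [inf_principal_neBot_iff]
    intro U hU
    obtain ⟨L, hL, hLU⟩ := mem_cocompact.1 hU
    obtain ⟨q, hq, hqL⟩ := not_subset.1 (hcon L hL)
    exact ⟨q, hLU hqL, hq⟩
  set l : Ultrafilter M := Ultrafilter.of (cocompact M ⊓ 𝓟 Dom) with hl
  have hle : (l : Filter M) ≤ cocompact M ⊓ 𝓟 Dom := Ultrafilter.of_le _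
  have hlc : (l : Filter M) ≤ cocompact M := hle.trans inf_le_left
  have hlD : ∀ᶠ q in (l : Filter M), q ∈ Dom := hle.trans inf_le_right (mem_principal_self Dom)
  obtain ⟨f, hf⟩ : ∃ f : M → M, ∀ q ∈ Dom, f q ∈ K ∧ g.CausalLE univ (f q) q := by
    classical
    have : ∀ q, ∃ p, q ∈ Dom → p ∈ K ∧ g.CausalLE univ p q := fun q => by
      by_cases hq : q ∈ Dom
      · obtain ⟨p, hp, hpq⟩ := hq.1
        exact ⟨p, fun _ => ⟨hp.1, hpq⟩⟩
      · exact ⟨q, fun h => absurd h hq⟩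
    choose f hf using this
    exact ⟨f, hf⟩
  obtain ⟨x, -, hx⟩ := hK.ultrafilter_le_nhds' (l.map f) (hlD.mono fun q hq => (hf q hq).1)
  obtain ⟨w, hw⟩ := g.exists_stablyBefore_left x
  obtain ⟨u, hu0, hu, huA, hlim⟩ := (escapes_of_ultrafilter (g := g) hlc).exists_seq
    ⟨f, hx, hlD.mono fun q hq => (hf q hq).2⟩ hw
  obtain ⟨γ, hγ, hγu, hlt⟩ := exists_isInextensibleTimelike_extending hu hlim
  obtain ⟨t, ht, -⟩ := hS.2 γ hγ
  obtain ⟨k, hk⟩ := exists_nat_gt t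
  obtain ⟨y, ⟨f', hf', hfq⟩, hy⟩ := huA k
  obtain ⟨q, hq1, hq2, hq3⟩ := ((hf'.eventually hy.eventually_right).and (hfq.and hlD)).exists
  have hlast : g.ChronLT (γ t) q := by
    have h1 := hlt t k hk
    rw [hγu] at h1
    exact h1.trans (hq1.of_causalLE hq2).chronLT
  rcases hq3.2 with h | ⟨s, hs, h⟩
  · exact hS.achronal ht h hlast
  · exact hS.achronal ht hs (hlast.trans h)

/-- In a globally hyperbolic spacetime the causal diamonds of compact sets are relatively
compact. -/
lemma GloballyHyperbolic.exists_compact_diamond (hg : g.GloballyHyperbolic univ) {K K' : Set M}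
    (hK : IsCompact K) (hK' : IsCompact K') :
    ∃ L, IsCompact L ∧ g.causalFuture univ K ∩ g.causalPast univ K' ⊆ L := by
  obtain ⟨S, hS⟩ := hg
  obtain ⟨L₁, hL₁, h₁⟩ := hS.exists_compact_causalFuture hK
  -- the points after `S` are dealt with by time reversal
  obtain ⟨L₂, hL₂, h₂⟩ := hS.reverse.exists_compact_causalFuture hK'
  refine ⟨L₁ ∪ L₂, hL₁.union hL₂, ?_⟩
  rintro q ⟨hq, hq'⟩
  rw [causalFuture_reverse] at h₂
  rcases hS.trichotomy q with h | h | ⟨s, hs, h⟩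
  · exact Or.inl (h₁ ⟨hq, Or.inl h⟩)
  · exact Or.inl (h₁ ⟨hq, Or.inr h⟩)
  · exact Or.inr (h₂ ⟨hq', Or.inr ⟨s, hs, h.reverse⟩⟩)

lemma GloballyHyperbolic.reverse {Ω : Set M} (hg : g.GloballyHyperbolic Ω) :
    g.reverse.GloballyHyperbolic Ω := by
  obtain ⟨S, hS⟩ := hg
  exact ⟨S, hS.reverse⟩

end SpacetimeStructure

end Cauchy

/-! ### Sections and Green's operators -/

section GreenOperators

variable {m : ℕ} {M : Type*} [TopologicalSpace M] [ChartedSpace (E m) M]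
  [IsManifold (𝓡 m) ∞ M]
  {𝕜 : Type*} [RCLike 𝕜]
  {F : Type*} [NormedAddCommGroup F] [NormedSpace ℝ F] [NormedSpace 𝕜 F] [IsScalarTower ℝ 𝕜 F]
  {V : M → Type*} [TopologicalSpace (TotalSpace F V)] [∀ x, TopologicalSpace (V x)]
  [∀ x, AddCommGroup (V x)] [∀ x, Module ℝ (V x)] [∀ x, Module 𝕜 (V x)]
  [FiberBundle F V] [VectorBundle ℝ F V] [VectorBundle 𝕜 F V]

/-- The product of a smooth section with a smooth real function. -/
def smulSection (f : C^∞⟮𝓡 m, M; 𝓘(ℝ), ℝ⟯) (s : smoothSections m 𝕜 F V (univ : Set M)) :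
    smoothSections m 𝕜 F V (univ : Set M) :=
  ⟨fun x => f x • (s : ∀ x, V x) x,
    f.contMDiff.contMDiffOn.smul_section s.2.1, fun x hx => absurd (mem_univ x) hx⟩

lemma smulSection_apply (f : C^∞⟮𝓡 m, M; 𝓘(ℝ), ℝ⟯) (s : smoothSections m 𝕜 F V (univ : Set M))
    (x : M) : (smulSection f s : ∀ x, V x) x = f x • (s : ∀ x, V x) x := rfl

lemma notMem_secSupp_of_eventually {s : smoothSections m 𝕜 F V (univ : Set M)} {p : M}
    (h : ∀ᶠ x in 𝓝 p, (s : ∀ x, V x) x = 0) : p ∉ secSupp s := by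
  rintro ⟨hp, -⟩
  obtain ⟨x, hx1, hx2⟩ := ((mem_closure_iff_frequently.1 hp).and_eventually h).exists
  exact hx1 hx2

lemma secSupp_subset_of_forall {s t : smoothSections m 𝕜 F V (univ : Set M)}
    (h : ∀ x, (t : ∀ x, V x) x = 0 → (s : ∀ x, V x) x = 0) : secSupp s ⊆ secSupp t :=
  inter_subset_inter_left _ (closure_mono fun x hx h' => hx (h x h'))

lemma isClosed_secSupp (s : smoothSections m 𝕜 F V (univ : Set M)) : IsClosed (secSupp s) := by
  rw [secSupp, inter_univ]
  exact isClosed_closure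

lemma mem_secSupp_of_ne_zero {s : smoothSections m 𝕜 F V (univ : Set M)} {x : M}
    (h : (s : ∀ x, V x) x ≠ 0) : x ∈ secSupp s := ⟨subset_closure h, mem_univ x⟩

lemma secSupp_smulSection_subset (f : C^∞⟮𝓡 m, M; 𝓘(ℝ), ℝ⟯)
    (s : smoothSections m 𝕜 F V (univ : Set M)) : secSupp (smulSection f s) ⊆ secSupp s :=
  secSupp_subset_of_forall fun x hx => by rw [smulSection_apply, hx, smul_zero]

lemma secSupp_neg (s : smoothSections m 𝕜 F V (univ : Set M)) : secSupp (-s) = secSupp s := by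
  simp [secSupp]

lemma secSupp_sub (s t : smoothSections m 𝕜 F V (univ : Set M)) :
    secSupp (s - t) ⊆ secSupp s ∪ secSupp t := by
  rw [sub_eq_add_neg, ← secSupp_neg t]
  exact secSupp_add s (-t)

namespace DiffOp

variable {P : DiffOp m 𝕜 F V (univ : Set M)} {g : SpacetimeStructure m M}
  {Gp Gm : compactSections m 𝕜 F V (univ : Set M) →ₗ[𝕜] smoothSections m 𝕜 F V (univ : Set M)}

lemma IsRetardedGreen.reverse (h : P.IsRetardedGreen g Gm) : P.IsAdvancedGreen g.reverse Gm :=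
  ⟨h.right_inv, h.left_inv, fun φ => by rw [g.causalFuture_reverse]; exact h.supp φ⟩

lemma injective_onCompact (hGp : P.IsAdvancedGreen g Gp) : Function.Injective P.onCompact := by
  rw [injective_iff_map_eq_zero]
  intro φ hφ
  have h := hGp.left_inv φ
  rw [hφ, map_zero] at h
  exact Subtype.ext h.symm

section CausalPropagator

variable (hGp : P.IsAdvancedGreen g Gp) (hGm : P.IsRetardedGreen g Gm)

lemma coe_causalPropagator (φ : compactSections m 𝕜 F V (univ : Set M)) :
    (causalPropagator hGp hGm φ : smoothSections m 𝕜 F V (univ : Set M)) = Gp φ - Gm φ := rfl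

lemma causalPropagator_onCompact (φ : compactSections m 𝕜 F V (univ : Set M)) :
    causalPropagator hGp hGm (P.onCompact φ) = 0 := by
  apply Subtype.ext
  rw [coe_causalPropagator, hGp.left_inv, hGm.left_inv, sub_self]
  rfl

lemma onSpacelikeCompact_causalPropagator (φ : compactSections m 𝕜 F V (univ : Set M)) :
    P.onSpacelikeCompact g (causalPropagator hGp hGm φ) = 0 := by
  apply Subtype.ext
  show P.toLin (Gp φ - Gm φ) = 0
  rw [map_sub, hGp.right_inv, hGm.right_inv, sub_self]

end CausalPropagator

variable [T2Space M] [SecondCountableTopology M]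

/-- A solution of `P u = 0` whose support lies in the causal future of a compact set vanishes on a
globally hyperbolic spacetime. Near a given point `x` it is replaced by `χ u`, where the cutoff
function `χ` is `1` near `J₋(x) ∩ supp u`. Then `χ u = G₊ P (χ u)`, and `P (χ u)` vanishes on the
causal past of `x`. -/
lemma IsAdvancedGreen.eq_zero_of_secSupp_subset (hGp : P.IsAdvancedGreen g Gp)
    (hg : g.GloballyHyperbolic univ) {u : smoothSections m 𝕜 F V (univ : Set M)}
    (hu : P.toLin u = 0) {K : Set M} (hK : IsCompact K)
    (hsupp : secSupp u ⊆ g.causalFuture univ K) : u = 0 := by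
  have : LocallyCompactSpace M := Manifold.locallyCompact_of_finiteDimensional (𝓡 m)
  ext x
  by_contra hx
  obtain ⟨L, hL, hKL⟩ := hg.exists_compact_diamond hK (isCompact_singleton (x := x))
  obtain ⟨T, hT, hLT⟩ := exists_compact_superset hL
  obtain ⟨χ, hχ1, hχ0, -⟩ := exists_contMDiffMap_one_nhds_of_subset_interior (n := ⊤) (𝓡 m)
    hL.isClosed hLT
  have hxL : x ∈ L := hKL ⟨hsupp (mem_secSupp_of_ne_zero hx), x, ⟨rfl, mem_univ x⟩, .refl⟩
  set v := smulSection χ u with hv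
  have hvT : secSupp v ⊆ T := by
    rw [secSupp, inter_univ]
    refine closure_minimal (fun y hy => ?_) hT.isClosed
    by_contra hyT
    exact hy (by rw [hv, smulSection_apply, hχ0 y hyT, zero_smul])
  let ψ : compactSections m 𝕜 F V (univ : Set M) :=
    ⟨v, isCompact_secSupp_of_subset v hT hvT (subset_univ _)⟩
  have hvx : (v : ∀ x, V x) x ≠ 0 := by
    rw [hv, smulSection_apply, (eventually_nhdsSet_iff_forall.1 hχ1 x hxL).self_of_nhds, one_smul]
    exact hx
  have h1 := hGp.supp (P.onCompact ψ)
  rw [hGp.left_inv] at h1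
  obtain ⟨p, ⟨hp, -⟩, hpx⟩ := h1 (mem_secSupp_of_ne_zero hvx)
  have hp' : p ∈ secSupp (P.toLin v) := hp
  have hpu : p ∈ secSupp u := secSupp_smulSection_subset χ u (P.secSupp_toLin v hp')
  have hpL : p ∈ L := hKL ⟨hsupp hpu, x, ⟨rfl, mem_univ x⟩, hpx⟩
  have h2 : P.toLin v = P.toLin (v - u) := by rw [map_sub, hu, sub_zero]
  rw [h2] at hp'
  refine notMem_secSupp_of_eventually ?_ (P.secSupp_toLin _ hp')
  filter_upwards [eventually_nhdsSet_iff_forall.1 hχ1 p hpL] with y hy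
  show (v : ∀ x, V x) y - (u : ∀ x, V x) y = 0
  rw [hv, smulSection_apply, hy, one_smul, sub_self]

/-- The advanced Green's operator recovers a section whose support lies in the causal future of a
compact set, not only a section of compact support. -/
lemma IsAdvancedGreen.apply_eq_of_toLin_eq (hGp : P.IsAdvancedGreen g Gp)
    (hg : g.GloballyHyperbolic univ) {s : smoothSections m 𝕜 F V (univ : Set M)}
    {ψ : compactSections m 𝕜 F V (univ : Set M)} (hs : P.toLin s = ψ) {K : Set M}
    (hK : IsCompact K) (hsupp : secSupp s ⊆ g.causalFuture univ K) : Gp ψ = s := by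
  refine sub_eq_zero.1 (hGp.eq_zero_of_secSupp_subset hg (u := Gp ψ - s)
    (K := secSupp ψ.1 ∪ K) ?_ (IsCompact.union ψ.2 hK) ?_)
  · rw [map_sub, hGp.right_inv, hs, sub_self]
  · rintro y hy
    rcases secSupp_sub _ _ hy with h | h
    · obtain ⟨p, hp, hpy⟩ := hGp.supp ψ h
      exact ⟨p, ⟨Or.inl hp.1, hp.2⟩, hpy⟩
    · obtain ⟨p, hp, hpy⟩ := hsupp h
      exact ⟨p, ⟨Or.inr hp.1, hp.2⟩, hpy⟩

/-- A section of spacelike compact support is the sum of a section supported in the future of a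
compact set and a section supported in the past of a compact set. -/
lemma exists_future_past_decomposition {s : smoothSections m 𝕜 F V (univ : Set M)}
    (hs : s ∈ spacelikeCompactSections 𝕜 F V g (univ : Set M)) :
    ∃ (s₁ s₂ : smoothSections m 𝕜 F V (univ : Set M)) (K₁ K₂ : Set M), s = s₁ + s₂ ∧
      IsCompact K₁ ∧ IsCompact K₂ ∧ secSupp s₁ ⊆ g.causalFuture univ K₁ ∧
      secSupp s₂ ⊆ g.causalPast univ K₂ := by
  have : LocallyCompactSpace M := Manifold.locallyCompact_of_finiteDimensional (𝓡 m)
  obtain ⟨K, -, hK, hsK⟩ := hs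
  obtain ⟨K₁, U₁, hK₁, hU₁, hKU₁, hUK₁⟩ := SpacetimeStructure.exists_open_causalFuture (g := g) hK
  obtain ⟨K₂, U₂, hK₂, hU₂, hKU₂, hUK₂⟩ :=
    SpacetimeStructure.exists_open_causalFuture (g := g.reverse) hK
  rw [g.causalFuture_reverse] at hKU₂ hUK₂
  have hcov : ∀ x ∈ secSupp s, x ∈ U₁ ∨ x ∈ U₂ := fun x hx =>
    (hsK hx).elim (fun h => Or.inr (hKU₂ h)) fun h => Or.inl (hKU₁ h)
  have hcl := isClosed_secSupp s
  obtain ⟨χ, hχ0, hχ1, -⟩ := exists_contMDiffMap_zero_one_nhds_of_isClosed (n := ⊤) (𝓡 m)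
    (s := secSupp s \ U₁) (t := secSupp s \ U₂) (hcl.sdiff hU₁) (hcl.sdiff hU₂)
    (disjoint_left.2 fun x h1 h2 => (hcov x h1.1).elim h1.2 h2.2)
  refine ⟨smulSection χ s, s - smulSection χ s, K₁, K₂, (add_sub_cancel _ _).symm, hK₁, hK₂, fun x hx => ?_,
    fun x hx => ?_⟩
  · refine hUK₁ ?_
    by_contra hxU
    have hxs := secSupp_smulSection_subset χ s hx
    refine notMem_secSupp_of_eventually ?_ hx
    filter_upwards [eventually_nhdsSet_iff_forall.1 hχ0 x ⟨hxs, hxU⟩] with y hy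
    rw [smulSection_apply, hy, zero_smul]
  · refine hUK₂ ?_
    by_contra hxU
    have hxs : x ∈ secSupp s := (secSupp_sub _ _ hx).elim id
      fun h => secSupp_smulSection_subset χ s h
    refine notMem_secSupp_of_eventually ?_ hx
    filter_upwards [eventually_nhdsSet_iff_forall.1 hχ1 x ⟨hxs, hxU⟩] with y hy
    show (s : ∀ x, V x) y - χ y • (s : ∀ x, V x) y = 0
    rw [hy, one_smul, sub_self]

lemma exact_onCompact_causalPropagator (hGp : P.IsAdvancedGreen g Gp)
    (hGm : P.IsRetardedGreen g Gm) (hg : g.GloballyHyperbolic univ) :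
    Function.Exact P.onCompact (causalPropagator hGp hGm) := by
  intro φ
  refine ⟨fun h => ?_, ?_⟩
  · have hG : Gp φ = Gm φ := sub_eq_zero.1 (congrArg Subtype.val h)
    obtain ⟨L, hL, hφL⟩ := hg.exists_compact_diamond φ.2 φ.2
    refine ⟨⟨Gp φ, isCompact_secSupp_of_subset _ hL (fun x hx => hφL ⟨hGp.supp φ hx, ?_⟩)
      (subset_univ _)⟩, Subtype.ext (hGp.right_inv φ)⟩
    rw [hG] at hx
    exact hGm.supp φ hx
  · rintro ⟨ψ, rfl⟩
    exact causalPropagator_onCompact hGp hGm ψ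

lemma exact_causalPropagator_onSpacelikeCompact (hGp : P.IsAdvancedGreen g Gp)
    (hGm : P.IsRetardedGreen g Gm) (hg : g.GloballyHyperbolic univ) :
    Function.Exact (causalPropagator hGp hGm) (P.onSpacelikeCompact g) := by
  intro s
  refine ⟨fun h => ?_, ?_⟩
  · have hPs : P.toLin s.1 = 0 := congrArg Subtype.val h
    obtain ⟨s₁, s₂, K₁, K₂, hsum, hK₁, hK₂, h₁, h₂⟩ := exists_future_past_decomposition s.2
    have hP₁₂ : P.toLin s₁ = -P.toLin s₂ := by
      rw [hsum, map_add] at hPs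
      exact eq_neg_of_add_eq_zero_left hPs
    -- `P s₁` is supported in the future of `K₁` and, as it equals `-P s₂`, in the past of `K₂`
    obtain ⟨L, hL, hKL⟩ := hg.exists_compact_diamond hK₁ hK₂
    let ψ : compactSections m 𝕜 F V (univ : Set M) :=
      ⟨P.toLin s₁, isCompact_secSupp_of_subset _ hL (fun x hx => hKL
        ⟨h₁ (P.secSupp_toLin s₁ hx), h₂ (P.secSupp_toLin s₂ (by
          rw [hP₁₂, secSupp_neg] at hx; exact hx))⟩) (subset_univ _)⟩
    have hGpψ : Gp ψ = s₁ := hGp.apply_eq_of_toLin_eq hg rfl hK₁ h₁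
    have hGmψ : Gm ψ = -s₂ := by
      refine hGm.reverse.apply_eq_of_toLin_eq hg.reverse (K := K₂) ?_ hK₂ ?_
      · rw [map_neg, ← hP₁₂]
      · rw [secSupp_neg, g.causalFuture_reverse]
        exact h₂
    refine ⟨ψ, Subtype.ext ?_⟩
    rw [coe_causalPropagator, hGpψ, hGmψ, sub_neg_eq_add, hsum]
  · rintro ⟨φ, rfl⟩
    exact onSpacelikeCompact_causalPropagator hGp hGm φ

end DiffOp

end GreenOperators

end GreenHyp

end

theorem mainTheorem3 {m : ℕ} {M : Type*} [TopologicalSpace M] [T2Space M]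
    [SecondCountableTopology M] [ChartedSpace (GreenHyp.E m) M] [IsManifold (𝓡 m) ∞ M]
    (g : GreenHyp.SpacetimeStructure m M)
    {𝕜 : Type*} [RCLike 𝕜]
    {F : Type*} [NormedAddCommGroup F] [NormedSpace ℝ F] [NormedSpace 𝕜 F] [IsScalarTower ℝ 𝕜 F]
    [FiniteDimensional 𝕜 F]
    {V : M → Type*} [TopologicalSpace (TotalSpace F V)] [∀ x, TopologicalSpace (V x)]
    [∀ x, AddCommGroup (V x)] [∀ x, Module ℝ (V x)] [∀ x, Module 𝕜 (V x)]
    [FiberBundle F V] [VectorBundle ℝ F V] [VectorBundle 𝕜 F V]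
    [ContMDiffVectorBundle ∞ F V (𝓡 m)]
    (P : GreenHyp.DiffOp m 𝕜 F V (univ : Set M)) (_hP : P.GreenHyperbolic g)
    (Gp Gm : GreenHyp.compactSections m 𝕜 F V (univ : Set M) →ₗ[𝕜]
      GreenHyp.smoothSections m 𝕜 F V (univ : Set M))
    (hGp : P.IsAdvancedGreen g Gp) (hGm : P.IsRetardedGreen g Gm) :
    -- the sequence is a complex
    P.onCompact.range ≤ (GreenHyp.DiffOp.causalPropagator hGp hGm).ker ∧
    (GreenHyp.DiffOp.causalPropagator hGp hGm).range ≤ (P.onSpacelikeCompact g).ker ∧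
    -- it is exact at the first term
    Function.Injective P.onCompact ∧
    -- on a globally hyperbolic spacetime it is exact everywhere
    (g.GloballyHyperbolic (univ : Set M) →
      Function.Exact P.onCompact (GreenHyp.DiffOp.causalPropagator hGp hGm) ∧
      Function.Exact (GreenHyp.DiffOp.causalPropagator hGp hGm) (P.onSpacelikeCompact g) ∧
      ∃ e : (GreenHyp.compactSections m 𝕜 F V (univ : Set M) ⧸
            (GreenHyp.DiffOp.causalPropagator hGp hGm).ker) ≃ₗ[𝕜] (P.onSpacelikeCompact g).ker,
        ∀ φ : GreenHyp.compactSections m 𝕜 F V (univ : Set M),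
          (e (Submodule.Quotient.mk φ) : GreenHyp.spacelikeCompactSections 𝕜 F V g univ) =
            GreenHyp.DiffOp.causalPropagator hGp hGm φ) := by

  refine ⟨?_, ?_, GreenHyp.DiffOp.injective_onCompact hGp, fun hg => ?_⟩
  · rintro _ ⟨φ, rfl⟩
    exact GreenHyp.DiffOp.causalPropagator_onCompact hGp hGm φ
  · rintro _ ⟨φ, rfl⟩
    exact GreenHyp.DiffOp.onSpacelikeCompact_causalPropagator hGp hGm φ
  · have hexact := GreenHyp.DiffOp.exact_causalPropagator_onSpacelikeCompact hGp hGm hg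
    refine ⟨GreenHyp.DiffOp.exact_onCompact_causalPropagator hGp hGm hg, hexact,
      (GreenHyp.DiffOp.causalPropagator hGp hGm).quotKerEquivRange.trans
        (LinearEquiv.ofEq _ _ (LinearMap.exact_iff.1 hexact).symm), fun φ => rfl⟩
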